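/- All rings are unital, not necessarily commutative. A skew derivation $(\tau,\delta)$ on a ring $R$ consists of a ring endomorphism $\tau$ of $R$ and an additive map $\delta:R\to R$ with $\delta(rs)=\tau(r)\delta(s)+\delta(r)s$ for all $r,s\in R$; in $R[y;\tau,\delta]$ one has $yr=\tau(r)y+\delta(r)$, and the powers of $y$ form a basis as a left $R$-module. A ring $R$ with Jacobson radical $J(R)$ is called a complete local ring if $R/J(R)$ is simple artinian and the $J(R)$-adic topology is Hausdorff and complete; $J(R)$ is then the unique maximal (two-sided) ideal of $R$. For a skew derivation $(\tau,\delta)$ on a complete local ring $R$, write $(y^is)_k\in R$ for the coefficients in $y^is=\sum_{k=0}^i(y^is)_k\,y^k$ in $R[y;\tau,\delta]$. A (well-defined) skew power series ring $R[[y;\tau,\delta]]$ is the additive group of all formal power series $\sum_{i\ge 0}r_iy^i$ with $r_i\in R$, made into a ring by $$\Big(\sum_i r_iy^i\Big)\Big(\sum_j s_jy^j\Big)=\sum_{n\ge 0}\Big(\sum_{j=0}^n\sum_{i=n-j}^\infty r_i\,(y^is_j)_{n-j}\Big)y^n,$$ where it is required that all the inner series converge in the $J(R)$-adic topology. Theorem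 2.1. Let $C$ be a complete local ring with maximal ideal $\mathfrak m$, let $R_0=C$, and let $R_n=C[y_1;\tau_1,\delta_1]\cdots[y_n;\tau_n,\delta_n]$ be an iterated skew polynomial ring, where $(\tau_l,\delta_l)$ is a skew derivation on $R_{l-1}=C[y_1;\tau_1,\delta_1]\cdots[y_{l-1};\tau_{l-1},\delta_{l-1}]$ for $1\le l\le n$. For $1\le l\le n$ let $I_{l-1}=\mathfrak m+\langle y_1,\dots,y_{l-1}\rangle\subseteq R_{l-1}$ (the two-sided ideal generated by $\mathfrak m$ and $y_1,\dots,y_{l-1}$), and assume that $$\tau_l(I_{l-1})\subseteq I_{l-1},\qquad \delta_l(R_{l-1})\subseteq I_{l-1},\qquad \delta_l(I_{l-1})\subseteq I_{l-1}^2 .$$ Then, with $S_0=C$, there exists an iterated skew power series ring $$S_n=C[[y_1;\hat\tau_1,\hat\delta_1]]\cdots[[y_n;\hat\tau_n,\hat\delta_n]],$$ that is, for each $1\le l\le n$ there is a skew derivation $(\hat\tau_l,\hat\delta_l)$ on $S_{l-1}$ such that $S_l=S_{l-1}[[y_l;\hat\tau_l,\hat\delta_l]]$ is a well-defined skew power series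 ring, $R_{l-1}$ is a subring of $S_{l-1}$ (compatibly with $C$ and the variables), $\hat\tau_l|_{R_{l-1}}=\tau_l$ and $\hat\delta_l|_{R_{l-1}}=\delta_l$. Moreover, for every $0\le l\le n$, and in particular for $l=n$, $S_l$ is a complete local ring with maximal ideal $\mathfrak m+\langle y_1,\dots,y_l\rangle$. -/

import Mathlib

universe u

/-- The sequence `a` converges to `L` in the `I`-adic topology. -/
def AdicTendsto {R : Type u} [Ring R] (I : Ideal R) (a : ℕ → R) (L : R) : Prop :=
  ∀ k : ℕ, ∃ N : ℕ, ∀ i, N ≤ i → a i - L ∈ I ^ k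

/-- The sequence `a` is a Cauchy sequence for the `I`-adic topology. -/
def IsAdicCauchy {R : Type u} [Ring R] (I : Ideal R) (a : ℕ → R) : Prop :=
  ∀ k : ℕ, ∃ N : ℕ, ∀ i j, N ≤ i → N ≤ j → a i - a j ∈ I ^ k

/-- The series `∑ i, a i` converges to `L` in the `I`-adic topology. -/
def AdicHasSum {R : Type u} [Ring R] (I : Ideal R) (a : ℕ → R) (L : R) : Prop :=
  AdicTendsto I (fun N => ∑ i ∈ Finset.range N, a i) L

/-- A complete local ring (not necessarily commutative): the quotient by the Jacobson radical `J`
is simple artinian, and the `J`-adic topology is Hausdorff and complete. The Jacobson radical is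
then the unique maximal two-sided ideal, "the maximal ideal" of the ring. -/
structure IsCompleteLocalRing (R : Type u) [Ring R] : Prop where
  simple : IsSimpleRing (R ⧸ Ring.jacobson R)
  artinian : IsArtinianRing (R ⧸ Ring.jacobson R)
  separated : ∀ x : R, (∀ k : ℕ, x ∈ Ring.jacobson R ^ k) → x = 0
  complete : ∀ a : ℕ → R, IsAdicCauchy (Ring.jacobson R) a →
    ∃ L : R, AdicTendsto (Ring.jacobson R) a L

/-- `(τ, δ)` is a skew derivation: `δ` is a left `τ`-derivation. -/
def IsSkewDerivation {R : Type u} [Ring R] (τ : R →+* R) (δ : R →+ R) : Prop :=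
  ∀ r s : R, δ (r * s) = τ r * δ s + δ r * s

/-- `T` is the skew polynomial ring `R[y; τ, δ]`: it contains `R` (through `ι`), it is a free left
`R`-module with basis `1, y, y², …`, and `y r = τ(r) y + δ(r)` for `r ∈ R`. -/
structure IsSkewPolynomialRing {R T : Type u} [Ring R] [Ring T] (τ : R →+* R) (δ : R →+ R)
    (ι : R →+* T) (y : T) : Prop where
  skew : IsSkewDerivation τ δ
  basis : Function.Bijective (fun f : ℕ →₀ R => f.sum fun i r => ι r * y ^ i)
  comm : ∀ r : R, y * ι r = ι (τ r) * y + ι (δ r)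

/-- `skewCoeff τ δ i r k` is the coefficient `(yⁱ r)_k` in `yⁱ r = ∑ₖ (yⁱ r)_k yᵏ`, obtained by
applying the rule `y a = τ(a) y + δ(a)` repeatedly. It vanishes for `k > i`. -/
def skewCoeff {R : Type u} [Ring R] (τ : R →+* R) (δ : R →+ R) : ℕ → R → ℕ → R
  | 0, r, 0 => r
  | 0, _, _ + 1 => 0
  | i + 1, r, 0 => δ (skewCoeff τ δ i r 0)
  | i + 1, r, k + 1 => τ (skewCoeff τ δ i r k) + δ (skewCoeff τ δ i r (k + 1))

/-- `S` is the (well-defined) skew power series ring `R[[y; τ, δ]]` over the ring `R` with its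
`J(R)`-adic topology. As an additive group `S` consists of all formal power series `∑ rᵢ yⁱ`,
recorded by their coefficients, with `R` the constants and `y` the variable; the series in
`(∑ rᵢ yⁱ) (∑ sⱼ yʲ) = ∑ₙ (∑_{j ≤ n} ∑_{i ≥ n - j} rᵢ (yⁱ sⱼ)_{n-j}) yⁿ` all converge in `R`, and
this formula is the multiplication of `S`. Below `p = (n - j, j)` and `i = p.1 + t`. -/
def IsSkewPowerSeriesRing {R S : Type u} [Ring R] [Ring S] (τ : R →+* R) (δ : R →+ R)
    (ι : R →+* S) (y : S) : Prop :=
  IsSkewDerivation τ δ ∧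
  ∃ coeff : S ≃+ (ℕ → R),
    (∀ r : R, coeff (ι r) = Pi.single 0 r) ∧
    coeff y = Pi.single 1 1 ∧
    ∀ (f g : S) (n : ℕ), ∃ c : ℕ × ℕ → R,
      (∀ p ∈ Finset.HasAntidiagonal.antidiagonal n,
        AdicHasSum (Ring.jacobson R)
          (fun t => coeff f (p.1 + t) * skewCoeff τ δ (p.1 + t) (coeff g p.2) p.1) (c p)) ∧
      coeff (f * g) n = ∑ p ∈ Finset.HasAntidiagonal.antidiagonal n, c p

/-- The data of an `n`-fold iterated extension `C = R₀ → R₁ → ⋯ → Rₙ` of rings: for each step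
`l : Fin n` a ring homomorphism `incl l` from `obj l.castSucc` to `obj l.succ`, a new element `y l`
of `obj l.succ`, and maps `τ l`, `δ l` on `obj l.castSucc`. -/
structure SkewTower (C : Type u) [Ring C] (n : ℕ) where
  obj : Fin (n + 1) → Type u
  [ring : ∀ l, Ring (obj l)]
  base : C ≃+* obj 0
  incl : ∀ l : Fin n, obj l.castSucc →+* obj l.succ
  y : ∀ l : Fin n, obj l.succ
  τ : ∀ l : Fin n, obj l.castSucc →+* obj l.castSucc
  δ : ∀ l : Fin n, obj l.castSucc →+ obj l.castSucc

namespace SkewTower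

attribute [instance] SkewTower.ring

variable {C : Type u} [Ring C] {n : ℕ}

/-- The tower is an iterated skew polynomial ring `C[y₁; τ₁, δ₁]⋯[yₙ; τₙ, δₙ]`. -/
def IsIteratedSkewPolynomialRing (T : SkewTower C n) : Prop :=
  ∀ l : Fin n, IsSkewPolynomialRing (T.τ l) (T.δ l) (T.incl l) (T.y l)

/-- The tower is an iterated skew power series ring `C[[y₁; τ₁, δ₁]]⋯[[yₙ; τₙ, δₙ]]`. -/
def IsIteratedSkewPowerSeriesRing (T : SkewTower C n) : Prop :=
  ∀ l : Fin n, IsSkewPowerSeriesRing (T.τ l) (T.δ l) (T.incl l) (T.y l)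

/-- The homomorphism from `C` to the `l`-th ring of the tower. -/
def ofBase (T : SkewTower C n) (l : Fin (n + 1)) : C →+* T.obj l :=
  Fin.induction (motive := fun l => C →+* T.obj l) (T.base : C →+* T.obj 0)
    (fun l f => (T.incl l).comp f) l

/-- The set `{y₁, …, y_l}` in the `l`-th ring of the tower. -/
def vars (T : SkewTower C n) (l : Fin (n + 1)) : Set (T.obj l) :=
  Fin.induction (motive := fun l => Set (T.obj l)) ∅
    (fun l s => insert (T.y l) (T.incl l '' s)) l

/-- The two-sided ideal `𝔪 + ⟨y₁, …, y_l⟩` of the `l`-th ring of the tower, where `𝔪 = J(C)`: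
the ideal generated by (the image of) `𝔪` and `y₁, …, y_l`. -/
def augIdeal (T : SkewTower C n) (l : Fin (n + 1)) : TwoSidedIdeal (T.obj l) :=
  TwoSidedIdeal.span (T.ofBase l '' (Ring.jacobson C : Set C)) ⊔ TwoSidedIdeal.span (T.vars l)

/-- `φ` embeds the tower `T` in the tower `T'` level by level: it is the identity on `C`, sends
variables to variables, and the maps `τ`, `δ` of `T'` extend those of `T`. -/
structure IsExtension (T T' : SkewTower C n) (φ : ∀ l, T.obj l →+* T'.obj l) : Prop where
  injective : ∀ l, Function.Injective (φ l)
  base : ∀ c : C, φ 0 (T.base c) = T'.base c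
  incl : ∀ (l : Fin n) (r : T.obj l.castSucc),
    φ l.succ (T.incl l r) = T'.incl l (φ l.castSucc r)
  y : ∀ l : Fin n, φ l.succ (T.y l) = T'.y l
  τ : ∀ (l : Fin n) (r : T.obj l.castSucc), T'.τ l (φ l.castSucc r) = φ l.castSucc (T.τ l r)
  δ : ∀ (l : Fin n) (r : T.obj l.castSucc), T'.δ l (φ l.castSucc r) = φ l.castSucc (T.δ l r)

end SkewTower

/-! The ring `S_l` is the completion of `R_l` for the powers of its augmentation ideal `I_l`,
generated by `J(C)` and the variables up to `y_l`.

Consider one step `T = R[y; τ, δ]`, with `I ⊆ R` and `J ⊆ T` consecutive augmentation ideals. By the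
Leibniz rule the hypotheses give `δ(I ^ k) ⊆ I ^ (k + 1)`, so `(yⁱ r)_k` gains `i - k` steps of the
filtration. Giving `y` weight one is therefore compatible with multiplication, and `J ^ k` consists
of the polynomials whose `i`-th coefficient lies in `I ^ (k - i)` (`mem_pow_iff`). So the
coefficient maps, `τ` and `δ` are continuous, the completion of `T` consists of all power series
over the completion of `R`, and its product formula is the limit of the polynomial one
(`coeffHat_mul_sub_mem`).

The topology must also be the one defined by the Jacobson radical. The kernel `level 1` lies in the
radical by geometric series. Its residue ring is `C / J(C)`, since modulo the variables only
constants remain, and this is simple, so `level 1` is the whole radical. Splitting off finitely many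
terms of a power series shows that `level k` equals the algebraic power `level 1 ^ k`
(`level_le_pow`), and likewise that `level 1` is the ideal generated by `J(C)` and the variables,
without taking closures (`completion_mem_augIdeal`). -/

/-! ### Completion along a two-sided ideal -/

/-- The families `(x k) ∈ ∏ R ⧸ I ^ k` which are compatible with the projections. -/
def compatibleFamilies {R : Type u} [Ring R] (I : Ideal R) [I.IsTwoSided] :
    Subring (∀ k : ℕ, R ⧸ I ^ k) where
  carrier := {x | ∀ k, ∃ r : R, ∀ j ≤ k, x j = Ideal.Quotient.mk (I ^ j) r}
  mul_mem' {x y} hx hy k := by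
    obtain ⟨r, hr⟩ := hx k
    obtain ⟨s, hs⟩ := hy k
    exact ⟨r * s, fun j hj => by rw [Pi.mul_apply, hr j hj, hs j hj, map_mul]⟩
  one_mem' k := ⟨1, fun j _ => by rw [Pi.one_apply, map_one]⟩
  add_mem' {x y} hx hy k := by
    obtain ⟨r, hr⟩ := hx k
    obtain ⟨s, hs⟩ := hy k
    exact ⟨r + s, fun j hj => by rw [Pi.add_apply, hr j hj, hs j hj, map_add]⟩
  zero_mem' k := ⟨0, fun j _ => by rw [Pi.zero_apply, map_zero]⟩
  neg_mem' {x} hx k := by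
    obtain ⟨r, hr⟩ := hx k
    exact ⟨-r, fun j hj => by rw [Pi.neg_apply, hr j hj, map_neg]⟩

/-- The completion of a ring for the adic topology of a two-sided ideal. -/
def RingCompletion {R : Type u} [Ring R] (I : Ideal R) [I.IsTwoSided] : Type u :=
  compatibleFamilies I

namespace RingCompletion

section Basic

variable {R : Type u} [Ring R] {I : Ideal R} [I.IsTwoSided]

instance : Ring (RingCompletion I) := inferInstanceAs (Ring (compatibleFamilies I))

variable (I) in
/-- The projection of the completion to `R ⧸ I ^ k`. -/
def proj (k : ℕ) : RingCompletion I →+* R ⧸ I ^ k :=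
  (Pi.evalRingHom (fun k : ℕ => R ⧸ I ^ k) k).comp (compatibleFamilies I).subtype

variable (I) in
/-- The canonical map from a ring to its completion. -/
def of : R →+* RingCompletion I :=
  RingHom.codRestrict (RingHom.pi fun k : ℕ => Ideal.Quotient.mk (I ^ k)) (compatibleFamilies I)
    fun r _ => ⟨r, fun _ _ => rfl⟩

variable (I) in
/-- The kernels of the projections, which form a filtration of the completion. -/
def level (k : ℕ) : Ideal (RingCompletion I) := RingHom.ker (proj I k)

instance (k : ℕ) : (level I k).IsTwoSided := inferInstanceAs (RingHom.ker (proj I k)).IsTwoSided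

/-- The element of the completion given by a compatible family. -/
def ofFamily (x : ∀ k : ℕ, R ⧸ I ^ k)
    (hx : ∀ k, ∃ r : R, ∀ j ≤ k, x j = Ideal.Quotient.mk (I ^ j) r) : RingCompletion I := ⟨x, hx⟩

theorem proj_ofFamily (x : ∀ k : ℕ, R ⧸ I ^ k)
    (hx : ∀ k, ∃ r : R, ∀ j ≤ k, x j = Ideal.Quotient.mk (I ^ j) r) (k : ℕ) :
    proj I k (ofFamily x hx) = x k := rfl

theorem proj_of (k : ℕ) (r : R) : proj I k (of I r) = Ideal.Quotient.mk (I ^ k) r := rfl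

theorem mem_level {k : ℕ} {x : RingCompletion I} : x ∈ level I k ↔ proj I k x = 0 := Iff.rfl

theorem of_mem_level {k : ℕ} {r : R} : of I r ∈ level I k ↔ r ∈ I ^ k := by
  rw [mem_level, proj_of, Ideal.Quotient.eq_zero_iff_mem]

theorem exists_proj_eq (x : RingCompletion I) (k : ℕ) :
    ∃ r : R, ∀ j ≤ k, proj I j x = Ideal.Quotient.mk (I ^ j) r := x.2 k

theorem exists_sub_of_mem (x : RingCompletion I) (k : ℕ) : ∃ r : R, x - of I r ∈ level I k := by
  obtain ⟨r, hr⟩ := exists_proj_eq x k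
  exact ⟨r, by rw [mem_level, map_sub, proj_of, hr k le_rfl, sub_self]⟩

/-- A compatible family has one representative in `R` serving all indices up to `k`, so this reduces
to `I ^ k ≤ I ^ j`. -/
theorem level_anti {j k : ℕ} (h : j ≤ k) : level I k ≤ level I j := by
  intro x hx
  obtain ⟨r, hr⟩ := exists_proj_eq x k
  rw [mem_level, hr k le_rfl, Ideal.Quotient.eq_zero_iff_mem] at hx
  rw [mem_level, hr j h, Ideal.Quotient.eq_zero_iff_mem]
  exact Ideal.pow_le_pow_right h hx

theorem level_zero : level I 0 = ⊤ := by
  refine (Ideal.eq_top_iff_one _).2 ?_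
  rw [← map_one (of I), of_mem_level, Submodule.pow_zero, Ideal.one_eq_top]
  trivial

theorem mem_level_zero (x : RingCompletion I) : x ∈ level I 0 := by
  rw [level_zero]; trivial

theorem of_mem_level_of_sub {k j : ℕ} (h : j ≤ k) {x : RingCompletion I} {r : R}
    (hr : x - of I r ∈ level I k) : r ∈ I ^ j ↔ x ∈ level I j := by
  rw [← of_mem_level]
  have := level_anti h hr
  constructor
  · intro h'
    simpa using add_mem this h'
  · intro h'
    simpa using sub_mem h' this

theorem mul_mem_level {a b : ℕ} {x y : RingCompletion I} (hx : x ∈ level I a)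
    (hy : y ∈ level I b) : x * y ∈ level I (a + b) := by
  obtain ⟨r, hr⟩ := exists_sub_of_mem x (a + b)
  obtain ⟨s, hs⟩ := exists_sub_of_mem y (a + b)
  have h : x * y = (x - of I r) * y + of I r * (y - of I s) + of I (r * s) := by
    rw [map_mul]; noncomm_ring
  rw [h]
  refine add_mem (add_mem (Ideal.mul_mem_right _ _ hr) (Ideal.mul_mem_left _ _ hs)) ?_
  rw [of_mem_level, Ideal.IsTwoSided.pow_add]
  exact Ideal.mul_mem_mul ((of_mem_level_of_sub (by omega) hr).2 hx)
    ((of_mem_level_of_sub (by omega) hs).2 hy)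

theorem eq_zero_of_mem_level {x : RingCompletion I} (h : ∀ k, x ∈ level I k) : x = 0 :=
  Subtype.ext (funext h)

theorem eq_of_sub_mem_level {x y : RingCompletion I} (h : ∀ k, x - y ∈ level I k) : x = y :=
  sub_eq_zero.1 (eq_zero_of_mem_level h)

theorem of_injective (h : ∀ r : R, (∀ k, r ∈ I ^ k) → r = 0) : Function.Injective (of I) := by
  refine (injective_iff_map_eq_zero _).2 fun r hr => h r fun k => ?_
  rw [← of_mem_level, hr]
  exact zero_mem _

theorem exists_limit (a : ℕ → RingCompletion I)
    (h : ∀ k, ∃ N, ∀ i j, N ≤ i → N ≤ j → a i - a j ∈ level I k) :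
    ∃ L, ∀ k, ∃ N, ∀ i, N ≤ i → a i - L ∈ level I k := by
  choose N hN using h
  have key : ∀ j k, j ≤ k → ∀ i, N k ≤ i → proj I j (a i) = proj I j (a (N j)) := by
    intro j k hjk i hi
    -- The moduli `N` need not be monotone, so both terms are compared with a common later one.
    have h1 := level_anti hjk (hN k i (max (N j) (N k)) hi (le_max_right _ _))
    have h2 := hN j (max (N j) (N k)) (N j) (le_max_left _ _) le_rfl
    have h3 := add_mem h1 h2
    rwa [sub_add_sub_cancel, mem_level, map_sub, sub_eq_zero] at h3
  refine ⟨ofFamily (fun k => proj I k (a (N k))) fun k => ?_, fun k => ⟨N k, fun i hi => ?_⟩⟩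
  · obtain ⟨r, hr⟩ := exists_proj_eq (a (N k)) k
    refine ⟨r, fun j hj => ?_⟩
    rw [← hr j hj, key j k hj _ le_rfl]
  · rw [mem_level, map_sub, proj_ofFamily, key k k le_rfl i hi, sub_self]

/-- A series whose `i`-th term lies in the `i`-th level converges. -/
theorem exists_sum (a : ℕ → RingCompletion I) (h : ∀ i, a i ∈ level I i) :
    ∃ L, ∀ k N, k ≤ N → ∑ i ∈ Finset.range N, a i - L ∈ level I k := by
  have hd : ∀ k i j, k ≤ i → i ≤ j →
      ∑ t ∈ Finset.range j, a t - ∑ t ∈ Finset.range i, a t ∈ level I k := by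
    intro k i j hi hij
    rw [← Finset.sum_Ico_eq_sub _ hij]
    refine sum_mem fun t ht => level_anti ?_ (h t)
    exact hi.trans (Finset.mem_Ico.1 ht).1
  obtain ⟨L, hL⟩ := exists_limit (fun N => ∑ i ∈ Finset.range N, a i) (fun k => ⟨k, by
    intro i j hi hj
    rcases le_total i j with hij | hij
    · rw [← neg_sub]; exact neg_mem (hd k i j hi hij)
    · exact hd k j i hj hij⟩)
  refine ⟨L, fun k N hN => ?_⟩
  obtain ⟨M, hM⟩ := hL k
  have := sub_mem (hM (max M N) (le_max_left _ _)) (hd k N (max M N) hN (le_max_right _ _))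
  simpa using this

end Basic

/-! ### Extending continuous maps to completions -/

section Map

variable {R R' : Type u} [Ring R] [Ring R'] {I : Ideal R} [I.IsTwoSided]
  {I' : Ideal R'} [I'.IsTwoSided]

/-- A representative modulo the `k`-th level. -/
noncomputable def rep (x : RingCompletion I) (k : ℕ) : R := (exists_sub_of_mem x k).choose

theorem sub_of_rep_mem (x : RingCompletion I) (k : ℕ) : x - of I (rep x k) ∈ level I k :=
  (exists_sub_of_mem x k).choose_spec

theorem sub_mem_pow {k : ℕ} {r s : R} {x : RingCompletion I} (hr : x - of I r ∈ level I k)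
    (hs : x - of I s ∈ level I k) : r - s ∈ I ^ k := by
  rw [← of_mem_level, map_sub]
  simpa using sub_mem hs hr

/-- The continuous extension to the completions of an additive map which lowers the filtrations
by at most `s`. -/
noncomputable def map (f : R →+ R') (s : ℕ) (hf : ∀ k, ∀ r ∈ I ^ (k + s), f r ∈ I' ^ k) :
    RingCompletion I →+ RingCompletion I' :=
  -- The class of `f r` modulo `I' ^ k` does not depend on the chosen approximation `r` of `x`, as
  -- soon as it is accurate to order `k + s`.
  have key : ∀ (x : RingCompletion I) (k m : ℕ) (r : R), k + s ≤ m → x - of I r ∈ level I m →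
      Ideal.Quotient.mk (I' ^ k) (f (rep x (k + s))) = Ideal.Quotient.mk (I' ^ k) (f r) := by
    intro x k m r h hr
    rw [Ideal.Quotient.eq, ← map_sub]
    exact hf k _ (sub_mem_pow (sub_of_rep_mem x _) (level_anti h hr))
  AddMonoidHom.mk'
    (fun x => ofFamily (fun k => Ideal.Quotient.mk (I' ^ k) (f (rep x (k + s)))) fun k =>
      ⟨f (rep x (k + s)), fun j hj => key x j (k + s) _ (by omega) (sub_of_rep_mem x _)⟩)
    (fun x y => Subtype.ext (funext fun k => by
      have := key (x + y) k (k + s) (rep x (k + s) + rep y (k + s)) le_rfl (by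
        have := add_mem (sub_of_rep_mem x (k + s)) (sub_of_rep_mem y (k + s))
        rwa [map_add, add_sub_add_comm])
      refine this.trans ?_
      rw [map_add, map_add]
      rfl))

variable {f : R →+ R'} {s : ℕ} {hf : ∀ k, ∀ r ∈ I ^ (k + s), f r ∈ I' ^ k}

theorem proj_map (x : RingCompletion I) (k : ℕ) :
    proj I' k (map f s hf x) = Ideal.Quotient.mk (I' ^ k) (f (rep x (k + s))) := rfl

theorem map_of (r : R) : map f s hf (of I r) = of I' (f r) := by
  refine eq_of_sub_mem_level fun k => ?_
  rw [mem_level, map_sub, sub_eq_zero, proj_map, proj_of, Ideal.Quotient.eq, ← map_sub]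
  refine hf k _ (sub_mem_pow (sub_of_rep_mem _ _) ?_)
  rw [sub_self]
  exact zero_mem _

theorem map_mem_level {k : ℕ} {x : RingCompletion I} (hx : x ∈ level I (k + s)) :
    map f s hf x ∈ level I' k := by
  rw [mem_level, proj_map, Ideal.Quotient.eq_zero_iff_mem]
  exact hf k _ ((of_mem_level_of_sub le_rfl (sub_of_rep_mem x _)).2 hx)

/-- The shift `s` used to build the extension may be wasteful. This recovers the true behaviour of
`f` on powers, for instance that `δ` raises the filtration by one although it is extended with `s =
0`. -/
theorem map_mem_level_of_pow {k m : ℕ} (h : ∀ r ∈ I ^ k, f r ∈ I' ^ m) {x : RingCompletion I}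
    (hx : x ∈ level I k) : map f s hf x ∈ level I' m := by
  obtain ⟨r, hr⟩ := exists_sub_of_mem x (max k (m + s))
  have h1 : map f s hf (x - of I r) ∈ level I' m := map_mem_level (level_anti (le_max_right _ _) hr)
  have h2 := h r ((of_mem_level_of_sub (le_max_left _ _) hr).2 hx)
  rw [← of_mem_level, ← map_of (hf := hf)] at h2
  simpa using add_mem h1 h2

/-- Continuous additive maps which agree on the image of `R` are equal. -/
theorem addHom_eq {g h : RingCompletion I →+ RingCompletion I'} (s : ℕ)
    (hg : ∀ k, ∀ x ∈ level I (k + s), g x ∈ level I' k)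
    (hh : ∀ k, ∀ x ∈ level I (k + s), h x ∈ level I' k)
    (heq : ∀ r, g (of I r) = h (of I r)) (x : RingCompletion I) : g x = h x := by
  refine eq_of_sub_mem_level fun k => ?_
  obtain ⟨r, hr⟩ := exists_sub_of_mem x (k + s)
  have := sub_mem (hg k _ hr) (hh k _ hr)
  rwa [map_sub, map_sub, heq, sub_sub_sub_cancel_right] at this

/-- A continuous additive map which is multiplicative on the image of `R` is multiplicative. -/
theorem map_mul_of_continuous {g : RingCompletion I →+ RingCompletion I'}
    (hg : ∀ k, ∀ x ∈ level I k, g x ∈ level I' k)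
    (hmul : ∀ a b, g (of I (a * b)) = g (of I a) * g (of I b)) (x y : RingCompletion I) :
    g (x * y) = g x * g y := by
  refine eq_of_sub_mem_level fun k => ?_
  obtain ⟨a, ha⟩ := exists_sub_of_mem x k
  obtain ⟨b, hb⟩ := exists_sub_of_mem y k
  have h : g (x * y) - g x * g y =
      g ((x - of I a) * y + of I a * (y - of I b)) -
        (g (x - of I a) * g y + g (of I a) * g (y - of I b)) := by
    have e : x * y = (x - of I a) * y + of I a * (y - of I b) + of I (a * b) := by
      rw [map_mul]; noncomm_ring
    conv_lhs => rw [e, map_add g _ (of I (a * b)), hmul]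
    rw [map_sub g x, map_sub g y]
    noncomm_ring
  rw [h]
  exact sub_mem (hg k _ (add_mem (Ideal.mul_mem_right _ _ ha) (Ideal.mul_mem_left _ _ hb)))
    (add_mem (Ideal.mul_mem_right _ _ (hg k _ ha)) (Ideal.mul_mem_left _ _ (hg k _ hb)))

/-- The extension to the completions of a ring homomorphism compatible with the filtrations. -/
noncomputable def mapHom (f : R →+* R') (hf : ∀ k, ∀ r ∈ I ^ k, f r ∈ I' ^ k) :
    RingCompletion I →+* RingCompletion I' :=
  have hf' : ∀ k, ∀ r ∈ I ^ (k + 0), (f : R →+ R') r ∈ I' ^ k := hf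
  have h : ∀ r, map (f : R →+ R') 0 hf' (of I r) = of I' (f r) := fun r => map_of r
  { map (f : R →+ R') 0 hf' with
    map_one' := (h 1).trans (by rw [map_one, map_one])
    map_mul' := map_mul_of_continuous (g := map (f : R →+ R') 0 hf')
      (fun _ _ hx => map_mem_level hx) (fun a b => by rw [h, h, h, map_mul, map_mul]) }

variable {φ : R →+* R'} {hφ : ∀ k, ∀ r ∈ I ^ k, φ r ∈ I' ^ k}

theorem mapHom_of (r : R) : mapHom φ hφ (of I r) = of I' (φ r) :=
  map_of (f := (φ : R →+ R')) (hf := hφ) r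

theorem mapHom_mem_level {k : ℕ} {x : RingCompletion I} (hx : x ∈ level I k) :
    mapHom φ hφ x ∈ level I' k :=
  map_mem_level (f := (φ : R →+ R')) (hf := hφ) hx

end Map

end RingCompletion

/-! ### Powers of ideals -/

theorem Ideal.map_mem_pow_of_forall {R S : Type u} [Ring R] [Ring S] {I : Ideal R} {J : Ideal S}
    {f : R →+* S} (h : ∀ r ∈ I, f r ∈ J) {k : ℕ} {r : R} (hr : r ∈ I ^ k) : f r ∈ J ^ k := by
  induction k generalizing r with
  | zero => rw [Submodule.pow_zero, Ideal.one_eq_top]; trivial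
  | succ k ih =>
    rw [Submodule.pow_succ] at hr ⊢
    induction hr using Submodule.mul_induction_on' with
    | mem_mul_mem a ha b hb => rw [map_mul]; exact Ideal.mul_mem_mul (ih ha) (h b hb)
    | add a _ b _ ha hb => rw [map_add]; exact add_mem ha hb

theorem Ideal.mul_mem_pow_add {R : Type u} [Ring R] {I : Ideal R} [I.IsTwoSided] {a b c : ℕ}
    {x y : R} (hx : x ∈ I ^ a) (hy : y ∈ I ^ b) (h : c ≤ a + b) : x * y ∈ I ^ c := by
  refine Ideal.pow_le_pow_right h ?_
  rw [Ideal.IsTwoSided.pow_add]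
  exact Ideal.mul_mem_mul hx hy

theorem Ideal.mem_pow_zero {R : Type u} [Ring R] (I : Ideal R) (x : R) : x ∈ I ^ 0 := by
  rw [Submodule.pow_zero, Ideal.one_eq_top]; trivial

/-! ### The coefficients `(yⁱ r)_k` and filtrations -/

section SkewCoeff

variable {R : Type u} [Ring R] (τ : R →+* R) (δ : R →+ R)

theorem skewCoeff_add (i : ℕ) (r s : R) (k : ℕ) :
    skewCoeff τ δ i (r + s) k = skewCoeff τ δ i r k + skewCoeff τ δ i s k := by
  induction i generalizing k with
  | zero => cases k <;> simp [skewCoeff]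
  | succ i ih =>
    cases k with
    | zero => simp [skewCoeff, ih]
    | succ k => simp only [skewCoeff, ih, map_add]; abel

/-- The coefficient `(yⁱ r)_k` as an additive function of `r`. -/
def skewCoeffHom (i k : ℕ) : R →+ R :=
  AddMonoidHom.mk' (fun r => skewCoeff τ δ i r k) fun r s => skewCoeff_add τ δ i r s k

theorem skewCoeff_zero_right (i k : ℕ) : skewCoeff τ δ i 0 k = 0 :=
  map_zero (skewCoeffHom τ δ i k)

theorem skewCoeff_sub (i : ℕ) (r s : R) (k : ℕ) :
    skewCoeff τ δ i (r - s) k = skewCoeff τ δ i r k - skewCoeff τ δ i s k :=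
  map_sub (skewCoeffHom τ δ i k) r s

theorem skewCoeff_eq_zero {i k : ℕ} (h : i < k) (r : R) : skewCoeff τ δ i r k = 0 := by
  induction i generalizing k with
  | zero => obtain ⟨k, rfl⟩ := Nat.exists_eq_add_of_lt h; simp [skewCoeff]
  | succ i ih =>
    obtain _ | k := k
    · omega
    · simp only [skewCoeff]
      rw [ih (by omega), ih (by omega), map_zero, map_zero, add_zero]

theorem map_skewCoeff {S : Type u} [Ring S] {τ' : S →+* S} {δ' : S →+ S} {τ : R →+* R}
    {δ : R →+ R} {f : R →+* S} (hτ : ∀ r, τ' (f r) = f (τ r)) (hδ : ∀ r, δ' (f r) = f (δ r))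
    (i : ℕ) (r : R) (k : ℕ) : skewCoeff τ' δ' i (f r) k = f (skewCoeff τ δ i r k) := by
  induction i generalizing k with
  | zero => cases k <;> simp [skewCoeff]
  | succ i ih => cases k <;> simp [skewCoeff, ih, hτ, hδ]

/-- A skew derivation which respects the filtration `F` shifts the filtration by the difference
of the degrees. -/
theorem skewCoeff_mem_of_filtration {τ : R →+* R} {δ : R →+ R} {F : ℕ → Ideal R} (hF : Antitone F)
    (hτ : ∀ k, ∀ r ∈ F k, τ r ∈ F k) (hδ : ∀ k, ∀ r ∈ F k, δ r ∈ F (k + 1)) {m : ℕ} {r : R}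
    (hr : r ∈ F m) (i k : ℕ) : skewCoeff τ δ i r k ∈ F (m + i - k) := by
  induction i generalizing k with
  | zero =>
    cases k with
    | zero => exact hr
    | succ k => exact zero_mem _
  | succ i ih =>
    cases k with
    | zero => exact hF (by omega) (hδ _ _ (ih 0))
    | succ k =>
      exact add_mem (hF (by omega) (hτ _ _ (ih k))) (hF (by omega) (hδ _ _ (ih (k + 1))))

variable {τ δ}

/-- Induction with the Leibniz rule: for `a ∈ I ^ k` and `b ∈ I`, the term `τ(a) δ(b)` lies in `I ^
k * I ^ 2` and `δ(a) b` in `I ^ (k + 1) * I`. -/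
theorem IsSkewDerivation.map_mem_pow (h : IsSkewDerivation τ δ) {I : Ideal R} [I.IsTwoSided]
    (hτ : ∀ r ∈ I, τ r ∈ I) (hδ : ∀ r, δ r ∈ I) (hδ₂ : ∀ r ∈ I, δ r ∈ I ^ 2) (k : ℕ) {r : R}
    (hr : r ∈ I ^ k) : δ r ∈ I ^ (k + 1) := by
  induction k generalizing r with
  | zero => rw [zero_add, Submodule.pow_one]; exact hδ r
  | succ k ih =>
    rw [Submodule.pow_succ] at hr
    induction hr using Submodule.mul_induction_on' with
    | mem_mul_mem a ha b hb =>
      rw [h]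
      refine add_mem (Ideal.mul_mem_pow_add (Ideal.map_mem_pow_of_forall hτ ha) (hδ₂ b hb)
        (by omega)) (Ideal.mul_mem_pow_add (b := 1) (ih ha) ?_ le_rfl)
      rwa [Submodule.pow_one]
    | add a _ b _ ha hb => rw [map_add]; exact add_mem ha hb

end SkewCoeff

/-! ### Skew polynomial rings: coefficients and products -/

namespace IsSkewPolynomialRing

variable {R T : Type u} [Ring R] [Ring T] {τ : R →+* R} {δ : R →+ R} {ι : R →+* T} {y : T}

/-- The additive group of a skew polynomial ring consists of the polynomials. -/
noncomputable def reprEquiv (h : IsSkewPolynomialRing τ δ ι y) : (ℕ →₀ R) ≃+ T :=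
  AddEquiv.ofBijective
    (Finsupp.liftAddHom fun i => (AddMonoidHom.mulRight (y ^ i)).comp (ι : R →+ T)) h.basis

/-- The coefficients of a skew polynomial. -/
noncomputable def coeff (h : IsSkewPolynomialRing τ δ ι y) (i : ℕ) : T →+ R :=
  (Finsupp.applyAddHom i).comp (h.reprEquiv.symm : T →+ (ℕ →₀ R))

variable (h : IsSkewPolynomialRing τ δ ι y)

include h

theorem coeff_monomial (r : R) (i j : ℕ) :
    h.coeff i (ι r * y ^ j) = if i = j then r else 0 := by
  have h1 : h.reprEquiv (Finsupp.single j r) = ι r * y ^ j :=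
    Finsupp.liftAddHom_apply_single _ j r
  rw [← h1]
  change h.reprEquiv.symm (h.reprEquiv (Finsupp.single j r)) i = _
  rw [AddEquiv.symm_apply_apply, Finsupp.single_apply]
  simp only [eq_comm]

theorem exists_eq_sum (x : T) : ∃ N, (∀ i, N ≤ i → h.coeff i x = 0) ∧
    ∀ M, N ≤ M → x = ∑ i ∈ Finset.range M, ι (h.coeff i x) * y ^ i := by
  obtain ⟨p, rfl⟩ := h.reprEquiv.surjective x
  have hc : ∀ i, h.coeff i (h.reprEquiv p) = p i := fun i => by
    change h.reprEquiv.symm (h.reprEquiv p) i = _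
    rw [AddEquiv.symm_apply_apply]
  have hb : ∀ i ∈ p.support, i < p.support.sup id + 1 := fun i hi =>
    Nat.lt_succ_of_le (Finset.le_sup (f := id) hi)
  refine ⟨p.support.sup id + 1, fun i hi => ?_, fun M hM => ?_⟩
  · rw [hc]
    by_contra hne
    exact absurd (hb i (Finsupp.mem_support_iff.2 hne)) (by omega)
  · simp only [hc]
    change (p.sum fun i r => ι r * y ^ i) = _
    refine Finsupp.sum_of_support_subset _ (fun i hi => ?_) _ fun i _ => ?_
    · exact Finset.mem_range.2 ((hb i hi).trans_le hM)
    · rw [map_zero, zero_mul]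

theorem exists_eq_map_add (x : T) : ∃ z, x = ι (h.coeff 0 x) + z * y := by
  obtain ⟨N, -, hN⟩ := h.exists_eq_sum x
  refine ⟨∑ i ∈ Finset.range N, ι (h.coeff (i + 1) x) * y ^ i, ?_⟩
  conv_lhs => rw [hN (N + 1) N.le_succ, Finset.sum_range_succ']
  rw [pow_zero, mul_one, add_comm, Finset.sum_mul]
  simp only [pow_succ, mul_assoc]

/-- The coefficient identities below are additive in the polynomial, so this reduces them to
monomials. -/
theorem addHom_eq {A : Type u} [AddCommGroup A] {f g : T →+ A}
    (hfg : ∀ r i, f (ι r * y ^ i) = g (ι r * y ^ i)) (x : T) : f x = g x := by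
  obtain ⟨N, -, hN⟩ := h.exists_eq_sum x
  rw [hN N le_rfl, map_sum, map_sum]
  exact Finset.sum_congr rfl fun i _ => hfg _ i

theorem coeff_mul_pow (x : T) (n j : ℕ) :
    h.coeff n (x * y ^ j) = if j ≤ n then h.coeff (n - j) x else 0 := by
  have key := h.addHom_eq (f := (h.coeff n).comp (AddMonoidHom.mulRight (y ^ j)))
    (g := if j ≤ n then h.coeff (n - j) else 0) (fun r i => ?_) x
  · refine key.trans ?_
    split_ifs <;> rfl
  · have : ι r * y ^ i * y ^ j = ι r * y ^ (i + j) := by rw [mul_assoc, pow_add]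
    change h.coeff n (ι r * y ^ i * y ^ j) = _
    rw [this, h.coeff_monomial]
    split_ifs with h1 h2 h2
    · rw [h.coeff_monomial, if_pos (by omega)]
    · omega
    · rw [h.coeff_monomial, if_neg (by omega)]
    · rfl

theorem coeff_map_mul (r : R) (x : T) (n : ℕ) : h.coeff n (ι r * x) = r * h.coeff n x :=
  h.addHom_eq (f := (h.coeff n).comp (AddMonoidHom.mulLeft (ι r)))
    (g := (AddMonoidHom.mulLeft r).comp (h.coeff n)) (fun s i => by
      change h.coeff n (ι r * (ι s * y ^ i)) = r * h.coeff n (ι s * y ^ i)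
      rw [← mul_assoc, ← map_mul, h.coeff_monomial, h.coeff_monomial, mul_ite, mul_zero]) x

theorem coeff_map (r : R) (n : ℕ) : h.coeff n (ι r) = if n = 0 then r else 0 := by
  simpa using h.coeff_monomial r n 0

theorem coeff_var (i : ℕ) : h.coeff i y = if i = 1 then 1 else 0 :=
  (congrArg (h.coeff i) (by rw [map_one, one_mul, pow_one])).trans (h.coeff_monomial 1 i 1)

theorem var_mul_monomial (r : R) (i : ℕ) :
    y * (ι r * y ^ i) = ι (τ r) * y ^ (i + 1) + ι (δ r) * y ^ i := by
  rw [← mul_assoc, h.comm, add_mul, mul_assoc, ← pow_succ']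

theorem coeff_zero_var_mul (x : T) : h.coeff 0 (y * x) = δ (h.coeff 0 x) :=
  h.addHom_eq (f := (h.coeff 0).comp (AddMonoidHom.mulLeft y)) (g := δ.comp (h.coeff 0))
    (fun s i => by
      change h.coeff 0 (y * (ι s * y ^ i)) = δ (h.coeff 0 (ι s * y ^ i))
      rw [h.var_mul_monomial, map_add, h.coeff_monomial, h.coeff_monomial, h.coeff_monomial,
        if_neg (by omega), zero_add, apply_ite δ, map_zero]) x

theorem coeff_succ_var_mul (x : T) (k : ℕ) :
    h.coeff (k + 1) (y * x) = τ (h.coeff k x) + δ (h.coeff (k + 1) x) :=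
  h.addHom_eq (f := (h.coeff (k + 1)).comp (AddMonoidHom.mulLeft y))
    (g := (τ : R →+ R).comp (h.coeff k) + δ.comp (h.coeff (k + 1)))
    (fun s i => by
      change h.coeff (k + 1) (y * (ι s * y ^ i)) =
        τ (h.coeff k (ι s * y ^ i)) + δ (h.coeff (k + 1) (ι s * y ^ i))
      rw [h.var_mul_monomial, map_add, h.coeff_monomial, h.coeff_monomial, h.coeff_monomial,
        h.coeff_monomial, apply_ite δ, map_zero, apply_ite τ, map_zero]
      simp only [Nat.add_right_cancel_iff]) x

theorem coeff_pow_mul_map (i : ℕ) (r : R) (k : ℕ) :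
    h.coeff k (y ^ i * ι r) = skewCoeff τ δ i r k := by
  induction i generalizing k with
  | zero => rw [pow_zero, one_mul, h.coeff_map]; cases k <;> rfl
  | succ i ih =>
    rw [pow_succ', mul_assoc]
    cases k with
    | zero => rw [h.coeff_zero_var_mul, ih]; rfl
    | succ k => rw [h.coeff_succ_var_mul, ih, ih]; rfl

theorem coeff_pow_mul (i n : ℕ) (x : T) : h.coeff n (y ^ i * x) =
    ∑ p ∈ Finset.HasAntidiagonal.antidiagonal n, skewCoeff τ δ i (h.coeff p.2 x) p.1 := by
  have key := h.addHom_eq (f := (h.coeff n).comp (AddMonoidHom.mulLeft (y ^ i)))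
    (g := ∑ p ∈ Finset.HasAntidiagonal.antidiagonal n, (skewCoeffHom τ δ i p.1).comp (h.coeff p.2))
    (fun r j => ?_) x
  · refine key.trans ?_
    rw [AddMonoidHom.finsetSum_apply]
    rfl
  · change h.coeff n (y ^ i * (ι r * y ^ j)) = _
    rw [AddMonoidHom.finsetSum_apply]
    change _ = ∑ p ∈ Finset.HasAntidiagonal.antidiagonal n,
      skewCoeff τ δ i (h.coeff p.2 (ι r * y ^ j)) p.1
    rw [← mul_assoc, h.coeff_mul_pow, h.coeff_pow_mul_map]
    simp only [h.coeff_monomial]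
    split_ifs with hj
    · rw [Finset.sum_eq_single (n - j, j)]
      · rw [if_pos rfl]
      · intro p hp hne
        rw [if_neg, skewCoeff_zero_right]
        rintro rfl
        rw [Finset.HasAntidiagonal.mem_antidiagonal] at hp
        exact hne (Prod.ext (by simp; omega) rfl)
      · intro hp
        exact absurd (Finset.HasAntidiagonal.mem_antidiagonal.2 (by simp; omega)) hp
    · refine (Finset.sum_eq_zero fun p hp => ?_).symm
      rw [Finset.HasAntidiagonal.mem_antidiagonal] at hp
      rw [if_neg (by omega), skewCoeff_zero_right]

/-- The sum is indexed as in the power series product and is valid for every sufficiently long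
truncation, so that it can be compared with partial sums in the completion. -/
theorem exists_coeff_mul (f g : T) (n : ℕ) : ∃ N, ∀ M, N ≤ M → h.coeff n (f * g) =
    ∑ p ∈ Finset.HasAntidiagonal.antidiagonal n, ∑ t ∈ Finset.range M,
      h.coeff (p.1 + t) f * skewCoeff τ δ (p.1 + t) (h.coeff p.2 g) p.1 := by
  obtain ⟨N, hN, hf⟩ := h.exists_eq_sum f
  refine ⟨N, fun M hM => ?_⟩
  conv_lhs => rw [hf N le_rfl]
  rw [Finset.sum_mul, map_sum]
  simp only [mul_assoc, h.coeff_map_mul, h.coeff_pow_mul, Finset.mul_sum]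
  rw [Finset.sum_comm]
  refine Finset.sum_congr rfl fun p _ => ?_
  have h1 := Finset.sum_range_add
    (fun i => h.coeff i f * skewCoeff τ δ i (h.coeff p.2 g) p.1) p.1 M
  -- The terms with `i < p.1` vanish because `yⁱ r` has degree at most `i`; this permits the
  -- reindexing `i = p.1 + t`.
  rw [Finset.sum_eq_zero (s := Finset.range p.1), zero_add] at h1
  · rw [← h1]
    refine Finset.sum_subset (Finset.range_mono (by omega)) fun i _ hi => ?_
    rw [hN i (by simpa using hi), zero_mul]
  · intro i hi
    rw [skewCoeff_eq_zero τ δ (Finset.mem_range.1 hi), mul_zero]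

/-! ### The filtration in which `y` has weight one -/

section Filtration

variable {I : Ideal R} [I.IsTwoSided] (hτ : ∀ r ∈ I, τ r ∈ I) (hδ : ∀ r, δ r ∈ I)
  (hδ₂ : ∀ r ∈ I, δ r ∈ I ^ 2)

include hτ hδ hδ₂

theorem skewCoeff_mem {m : ℕ} {r : R} (hr : r ∈ I ^ m) (i k : ℕ) :
    skewCoeff τ δ i r k ∈ I ^ (m + i - k) :=
  skewCoeff_mem_of_filtration (F := fun k => I ^ k) (fun _ _ hab => Ideal.pow_le_pow_right hab)
    (fun _ _ hr => Ideal.map_mem_pow_of_forall hτ hr)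
    (fun k _ hr => h.skew.map_mem_pow hτ hδ hδ₂ k hr) hr i k

/-- Weights add up: the left factor contributes `a - (p.1 + t)`, the right one `b - p.2`, and moving
`y` past it gains `t`; together at least `a + b - n`. -/
theorem coeff_mul_mem {a b : ℕ} {f g : T} (hf : ∀ i, h.coeff i f ∈ I ^ (a - i))
    (hg : ∀ i, h.coeff i g ∈ I ^ (b - i)) (n : ℕ) : h.coeff n (f * g) ∈ I ^ (a + b - n) := by
  obtain ⟨N, hN⟩ := h.exists_coeff_mul f g n
  rw [hN N le_rfl]
  refine sum_mem fun p hp => sum_mem fun t _ => ?_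
  rw [Finset.HasAntidiagonal.mem_antidiagonal] at hp
  exact Ideal.mul_mem_pow_add (hf _) (h.skewCoeff_mem hτ hδ hδ₂ (hg _) _ _) (by omega)

/-- The two-sided ideal of all skew polynomials with constant term in `I`. -/
noncomputable def constIdeal : TwoSidedIdeal T :=
  -- Only the constant term is restricted at weight one, since `I ^ 0` is everything. Hence being an
  -- ideal is the product estimate for the weights `(0, 1)` and `(1, 0)`.
  have key : ∀ x, h.coeff 0 x ∈ I ↔ ∀ i, h.coeff i x ∈ I ^ (1 - i) := fun x => by
    refine ⟨fun hx i => ?_, fun hx => by simpa [Submodule.pow_one] using hx 0⟩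
    obtain _ | i := i
    · rwa [Nat.sub_zero, Submodule.pow_one]
    · rw [Nat.sub_eq_zero_of_le (by omega)]
      exact Ideal.mem_pow_zero _ _
  have top : ∀ x i, h.coeff i x ∈ I ^ (0 - i) := fun x i => by
    rw [Nat.zero_sub]; exact Ideal.mem_pow_zero _ _
  TwoSidedIdeal.mk' {x | h.coeff 0 x ∈ I} (by simp)
    (fun hx hy => by simpa using add_mem hx hy)
    (fun hx => by simpa using hx)
    (fun {x z} hz => (key _).2 fun i => by
      simpa using h.coeff_mul_mem hτ hδ hδ₂ (top x) ((key z).1 hz) i)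
    (fun {x z} hx => (key _).2 fun i => by
      simpa using h.coeff_mul_mem hτ hδ hδ₂ ((key x).1 hx) (top z) i)

theorem mem_constIdeal {x : T} : x ∈ h.constIdeal hτ hδ hδ₂ ↔ h.coeff 0 x ∈ I := by
  simp [constIdeal]

/-- One direction is the product estimate. For the other, each monomial `ι r * y ^ i` with `r ∈ I ^
(k - i)` lies in `J ^ (k - i) * J ^ i`. -/
theorem mem_pow_iff {J : Ideal T} [J.IsTwoSided] (hJ : ∀ x, x ∈ J ↔ h.coeff 0 x ∈ I) (k : ℕ)
    (x : T) : x ∈ J ^ k ↔ ∀ i, h.coeff i x ∈ I ^ (k - i) := by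
  have hy : y ∈ J := by
    rw [hJ, h.coeff_var, if_neg (by omega)]
    exact zero_mem _
  have hι : ∀ r ∈ I, ι r ∈ J := fun r hr => by rwa [hJ, h.coeff_map, if_pos rfl]
  constructor
  · intro hx
    induction k generalizing x with
    | zero => intro i; rw [Nat.zero_sub]; exact Ideal.mem_pow_zero _ _
    | succ k ih =>
      rw [Submodule.pow_succ] at hx
      induction hx using Submodule.mul_induction_on' with
      | mem_mul_mem a ha b hb =>
        refine h.coeff_mul_mem hτ hδ hδ₂ (ih a ha) fun i => ?_
        obtain _ | i := i
        · rw [Nat.sub_zero, Submodule.pow_one]; exact (hJ b).1 hb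
        · rw [Nat.sub_eq_zero_of_le (by omega)]
          exact Ideal.mem_pow_zero _ _
      | add a _ b _ ha hb => intro i; rw [map_add]; exact add_mem (ha i) (hb i)
  · intro hx
    obtain ⟨N, -, hN⟩ := h.exists_eq_sum x
    rw [hN N le_rfl]
    have hyi : ∀ i, y ^ i ∈ J ^ i := fun i => by
      induction i with
      | zero => exact Ideal.mem_pow_zero _ _
      | succ i ih => rw [pow_succ, Submodule.pow_succ]; exact Ideal.mul_mem_mul ih hy
    exact sum_mem fun i _ =>
      Ideal.mul_mem_pow_add (Ideal.map_mem_pow_of_forall hι (hx i)) (hyi i) (by omega)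

end Filtration

end IsSkewPolynomialRing

/-! ### Completing a skew polynomial ring to a skew power series ring -/

open RingCompletion

/-- `T = R[y; τ, δ]` where the skew derivation respects the `I`-adic filtration, and `J` consists
of the skew polynomials with constant term in `I`. -/
structure IsFilteredSkewPolynomialRing {R T : Type u} [Ring R] [Ring T] (τ : R →+* R) (δ : R →+ R)
    (ι : R →+* T) (y : T) (I : Ideal R) (J : Ideal T) : Prop
    extends IsSkewPolynomialRing τ δ ι y where
  τ_mem : ∀ r ∈ I, τ r ∈ I
  δ_mem : ∀ r, δ r ∈ I
  δ_mem_sq : ∀ r ∈ I, δ r ∈ I ^ 2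
  mem_iff : ∀ x, x ∈ J ↔ toIsSkewPolynomialRing.coeff 0 x ∈ I

namespace IsFilteredSkewPolynomialRing

variable {R T : Type u} [Ring R] [Ring T] {τ : R →+* R} {δ : R →+ R} {ι : R →+* T} {y : T}
  {I : Ideal R} {J : Ideal T} (h : IsFilteredSkewPolynomialRing τ δ ι y I J)

include h

theorem τ_mem_pow (k : ℕ) (r : R) (hr : r ∈ I ^ k) : τ r ∈ I ^ k :=
  Ideal.map_mem_pow_of_forall h.τ_mem hr

theorem ι_mem_pow (k : ℕ) (r : R) (hr : r ∈ I ^ k) : ι r ∈ J ^ k := by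
  refine Ideal.map_mem_pow_of_forall (fun r hr => ?_) hr
  rwa [h.mem_iff, h.coeff_map, if_pos rfl]

theorem y_mem : y ∈ J := by
  rw [h.mem_iff, h.coeff_var, if_neg (by omega)]
  exact zero_mem _

theorem var_pow_mem [J.IsTwoSided] (i : ℕ) : of J y ^ i ∈ level J i := by
  induction i with
  | zero => exact mem_level_zero _
  | succ i ih =>
    rw [pow_succ]
    refine mul_mem_level ih ?_
    rw [of_mem_level, Submodule.pow_one]
    exact h.y_mem

variable [I.IsTwoSided]

theorem δ_mem_pow_succ (k : ℕ) (r : R) (hr : r ∈ I ^ k) : δ r ∈ I ^ (k + 1) :=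
  h.skew.map_mem_pow h.τ_mem h.δ_mem h.δ_mem_sq k hr

theorem δ_mem_pow (k : ℕ) (r : R) (hr : r ∈ I ^ (k + 0)) : δ r ∈ I ^ k :=
  Ideal.pow_le_pow_right k.le_succ (h.δ_mem_pow_succ k r hr)

/-- The extension of `τ` to the completion. -/
noncomputable def τHat : RingCompletion I →+* RingCompletion I := mapHom τ h.τ_mem_pow

/-- The extension of `δ` to the completion. -/
noncomputable def δHat : RingCompletion I →+ RingCompletion I := map δ 0 h.δ_mem_pow

theorem τHat_of (r : R) : h.τHat (of I r) = of I (τ r) := mapHom_of r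

theorem δHat_of (r : R) : h.δHat (of I r) = of I (δ r) := map_of r

theorem τHat_mem {k : ℕ} {x : RingCompletion I} (hx : x ∈ level I k) : h.τHat x ∈ level I k :=
  mapHom_mem_level hx

theorem δHat_mem_succ {k : ℕ} {x : RingCompletion I} (hx : x ∈ level I k) :
    h.δHat x ∈ level I (k + 1) :=
  map_mem_level_of_pow (h.δ_mem_pow_succ k) hx

theorem δHat_mem {k : ℕ} {x : RingCompletion I} (hx : x ∈ level I k) : h.δHat x ∈ level I k :=
  level_anti k.le_succ (h.δHat_mem_succ hx)

theorem skewCoeff_hat_mem {m : ℕ} {r : RingCompletion I} (hr : r ∈ level I m) (i k : ℕ) :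
    skewCoeff h.τHat h.δHat i r k ∈ level I (m + i - k) :=
  skewCoeff_mem_of_filtration (F := level I) (fun _ _ hab => level_anti hab)
    (fun _ _ => h.τHat_mem) (fun _ _ => h.δHat_mem_succ) hr i k

/-- Both sides are additive and continuous in each variable separately, so density of `R` is used
once per variable. -/
theorem isSkewDerivation_hat : IsSkewDerivation h.τHat h.δHat := by
  intro x z
  refine RingCompletion.addHom_eq 0 (g := h.δHat.comp (AddMonoidHom.mulRight z))
    (h := (AddMonoidHom.mulRight (h.δHat z)).comp (h.τHat : RingCompletion I →+ RingCompletion I)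
      + (AddMonoidHom.mulRight z).comp h.δHat)
    (fun k x hx => h.δHat_mem (Ideal.mul_mem_right _ _ hx))
    (fun k x hx => add_mem (Ideal.mul_mem_right _ _ (h.τHat_mem hx))
      (Ideal.mul_mem_right _ _ (h.δHat_mem hx)))
    (fun a => ?_) x
  refine RingCompletion.addHom_eq 0 (g := h.δHat.comp (AddMonoidHom.mulLeft (of I a)))
    (h := (AddMonoidHom.mulLeft (h.τHat (of I a))).comp h.δHat
      + AddMonoidHom.mulLeft (h.δHat (of I a)))
    (fun k x hx => h.δHat_mem (Ideal.mul_mem_left _ _ hx))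
    (fun k x hx => add_mem (Ideal.mul_mem_left _ _ (h.δHat_mem hx))
      (Ideal.mul_mem_left _ _ hx))
    (fun b => ?_) z
  change h.δHat (of I a * of I b) = h.τHat (of I a) * h.δHat (of I b) + h.δHat (of I a) * of I b
  rw [← map_mul, h.τHat_of, h.δHat_of, h.δHat_of, h.δHat_of, h.skew, map_add, map_mul, map_mul]

variable [J.IsTwoSided]

theorem mem_pow (k : ℕ) (x : T) : x ∈ J ^ k ↔ ∀ i, h.coeff i x ∈ I ^ (k - i) :=
  h.mem_pow_iff h.τ_mem h.δ_mem h.δ_mem_sq h.mem_iff k x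

theorem coeff_mem_pow (i k : ℕ) (x : T) (hx : x ∈ J ^ (k + i)) : h.coeff i x ∈ I ^ k := by
  simpa using (h.mem_pow _ _).1 hx i

theorem separated (hI : ∀ r : R, (∀ k, r ∈ I ^ k) → r = 0) (x : T) (hx : ∀ k, x ∈ J ^ k) :
    x = 0 := by
  obtain ⟨N, -, hN⟩ := h.exists_eq_sum x
  rw [hN N le_rfl]
  refine Finset.sum_eq_zero fun i _ => ?_
  rw [hI _ fun k => h.coeff_mem_pow i k x (hx _), map_zero, zero_mul]

/-- The inclusion of the completion of `R` in the completion of `R[y; τ, δ]`. -/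
noncomputable def ιHat : RingCompletion I →+* RingCompletion J := mapHom ι h.ι_mem_pow

/-- The extension of the coefficient functions to the completion. -/
noncomputable def coeffHat (i : ℕ) : RingCompletion J →+ RingCompletion I :=
  map (h.coeff i) i (h.coeff_mem_pow i)

theorem ιHat_of (r : R) : h.ιHat (of I r) = of J (ι r) := mapHom_of r

theorem coeffHat_of (i : ℕ) (x : T) : h.coeffHat i (of J x) = of I (h.coeff i x) := map_of x

theorem ιHat_mem {k : ℕ} {x : RingCompletion I} (hx : x ∈ level I k) : h.ιHat x ∈ level J k :=
  mapHom_mem_level hx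

theorem coeffHat_mem {i k : ℕ} {x : RingCompletion J} (hx : x ∈ level J k) :
    h.coeffHat i x ∈ level I (k - i) :=
  map_mem_level_of_pow (fun r hr => (h.mem_pow k r).1 hr i) hx

theorem coeffHat_mul_pow (x : RingCompletion J) (n j : ℕ) :
    h.coeffHat n (x * of J y ^ j) = if j ≤ n then h.coeffHat (n - j) x else 0 := by
  have key := RingCompletion.addHom_eq n
    (g := (h.coeffHat n).comp (AddMonoidHom.mulRight (of J y ^ j)))
    (h := if j ≤ n then h.coeffHat (n - j) else 0)
    (fun k x hx => by simpa using h.coeffHat_mem (i := n) (Ideal.mul_mem_right (of J y ^ j) _ hx))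
    (fun k x hx => by
      split_ifs
      · exact level_anti (by omega) (h.coeffHat_mem hx)
      · exact zero_mem _)
    (fun r => by
      change h.coeffHat n (of J r * of J y ^ j) = _
      rw [← map_pow, ← map_mul, h.coeffHat_of, h.coeff_mul_pow]
      split_ifs
      · rw [h.coeffHat_of]
      · rw [map_zero]; rfl) x
  refine key.trans ?_
  split_ifs <;> rfl

theorem coeffHat_ιHat (r : RingCompletion I) (n : ℕ) :
    h.coeffHat n (h.ιHat r) = if n = 0 then r else 0 := by
  have key := RingCompletion.addHom_eq n
    (g := (h.coeffHat n).comp (h.ιHat : RingCompletion I →+ RingCompletion J))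
    (h := if n = 0 then AddMonoidHom.id _ else 0)
    (fun k x hx => by simpa using h.coeffHat_mem (i := n) (h.ιHat_mem hx))
    (fun k x hx => by
      split_ifs
      · exact level_anti (by omega) hx
      · exact zero_mem _)
    (fun r => by
      change h.coeffHat n (h.ιHat (of I r)) = _
      rw [h.ιHat_of, h.coeffHat_of, h.coeff_map]
      split_ifs
      · rfl
      · rw [map_zero]; rfl) r
  refine key.trans ?_
  split_ifs <;> rfl

theorem coeffHat_monomial (r : RingCompletion I) (i j : ℕ) :
    h.coeffHat i (h.ιHat r * of J y ^ j) = if i = j then r else 0 := by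
  rw [h.coeffHat_mul_pow]
  split_ifs with h1 h2 h2
  · rw [h.coeffHat_ιHat, if_pos (by omega)]
  · rw [h.coeffHat_ιHat, if_neg (by omega)]
  · omega
  · rfl

theorem mem_level_iff (k : ℕ) (x : RingCompletion J) :
    x ∈ level J k ↔ ∀ i, h.coeffHat i x ∈ level I (k - i) := by
  refine ⟨fun hx i => h.coeffHat_mem hx, fun hx => ?_⟩
  obtain ⟨r, hr⟩ := exists_sub_of_mem x k
  rw [← of_mem_level_of_sub le_rfl hr, h.mem_pow]
  intro i
  rw [← of_mem_level, ← h.coeffHat_of]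
  simpa using sub_mem (hx i) (h.coeffHat_mem (i := i) hr)

theorem coeffHat_ext {x z : RingCompletion J} (hxz : ∀ i, h.coeffHat i x = h.coeffHat i z) :
    x = z := by
  refine eq_of_sub_mem_level fun k => ?_
  rw [h.mem_level_iff]
  intro i
  rw [map_sub, hxz, sub_self]
  exact zero_mem _

theorem exists_coeffHat_eq (s : ℕ → RingCompletion I) : ∃ x, ∀ i, h.coeffHat i x = s i := by
  obtain ⟨L, hL⟩ := exists_sum (fun i => h.ιHat (s i) * of J y ^ i)
    fun _ => Ideal.mul_mem_left _ _ (h.var_pow_mem _)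
  refine ⟨L, fun i => (eq_of_sub_mem_level fun k => ?_).symm⟩
  -- Taking the `i`-th coefficient costs `i` levels, hence precision `k + i`; one further term makes
  -- the partial sum contain the index `i`.
  have := h.coeffHat_mem (i := i) (hL (k + i) (k + i + 1) (by omega))
  rw [map_sub, map_sum, Nat.add_sub_cancel] at this
  simpa only [h.coeffHat_monomial, Finset.sum_ite_eq, Finset.mem_range,
    if_pos (show i < k + i + 1 by omega)] using this

/-- The completion of `R[y; τ, δ]` consists of the power series over the completion of `R`. -/
noncomputable def coeffEquiv : RingCompletion J ≃+ (ℕ → RingCompletion I) :=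
  AddEquiv.ofBijective
    (AddMonoidHom.mk' (fun x i => h.coeffHat i x) fun x z => funext fun _ => map_add _ x z)
    ⟨fun _ _ hxz => h.coeffHat_ext fun i => congrFun hxz i,
      fun s => (h.exists_coeffHat_eq s).imp fun _ hx => funext hx⟩

theorem coeffEquiv_apply (x : RingCompletion J) (i : ℕ) : h.coeffEquiv x i = h.coeffHat i x := rfl

/-- Replacing `f` and `g` by polynomials modulo `level J (k + n)` changes every term by an element
of `level I k`, uniformly in `M`; for polynomials the truncated formula is exact. -/
theorem coeffHat_mul_sub_mem (f g : RingCompletion J) (n k : ℕ) : ∃ N, ∀ M, N ≤ M →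
    h.coeffHat n (f * g) - ∑ p ∈ Finset.HasAntidiagonal.antidiagonal n, ∑ t ∈ Finset.range M,
      h.coeffHat (p.1 + t) f * skewCoeff h.τHat h.δHat (p.1 + t) (h.coeffHat p.2 g) p.1
        ∈ level I k := by
  obtain ⟨a, ha⟩ := exists_sub_of_mem f (k + n)
  obtain ⟨b, hb⟩ := exists_sub_of_mem g (k + n)
  obtain ⟨N, hN⟩ := h.exists_coeff_mul a b n
  refine ⟨N, fun M hM => ?_⟩
  have h1 : h.coeffHat n (f * g) - of I (h.coeff n (a * b)) ∈ level I k := by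
    have e : f * g - of J (a * b) = (f - of J a) * g + of J a * (g - of J b) := by
      rw [map_mul]; noncomm_ring
    rw [← h.coeffHat_of, ← map_sub, e]
    simpa using h.coeffHat_mem (i := n)
      (add_mem (Ideal.mul_mem_right g _ ha) (Ideal.mul_mem_left _ (of J a) hb))
  refine (sub_mem_comm_iff.1 ?_)
  rw [← sub_add_sub_cancel _ (of I (h.coeff n (a * b)))]
  refine add_mem ?_ (sub_mem_comm_iff.1 h1)
  rw [hN M hM, map_sum, ← Finset.sum_sub_distrib]
  refine sum_mem fun p hp => ?_
  rw [map_sum, ← Finset.sum_sub_distrib]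
  refine sum_mem fun t _ => ?_
  rw [Finset.HasAntidiagonal.mem_antidiagonal] at hp
  rw [map_mul, ← map_skewCoeff h.τHat_of h.δHat_of, ← h.coeffHat_of, ← h.coeffHat_of]
  have e : ∀ u v w z : RingCompletion I, u * v - w * z = (u - w) * v + w * (v - z) := by
    intros; noncomm_ring
  rw [e, ← skewCoeff_sub, ← map_sub, ← map_sub]
  refine add_mem ?_ (Ideal.mul_mem_left _ _
    (level_anti (by omega) (h.skewCoeff_hat_mem (h.coeffHat_mem hb) _ _)))
  -- The factor from `f` has lost `p.1 + t` levels, but the skew coefficient regains `t`, and `p.1 ≤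
  -- n`.
  exact level_anti (by omega)
    (mul_mem_level (h.coeffHat_mem ha) (h.skewCoeff_hat_mem (mem_level_zero _) _ _))

/-- The assumption `hI` turns convergence for the levels into convergence for the radical-adic
topology, which the definition requires. -/
theorem isSkewPowerSeriesRing_hat
    (hI : ∀ k, level I k = Ring.jacobson (RingCompletion I) ^ k) :
    IsSkewPowerSeriesRing h.τHat h.δHat h.ιHat (of J y) := by
  refine ⟨h.isSkewDerivation_hat, h.coeffEquiv, fun r => funext fun i => ?_, funext fun i => ?_,
    fun f g n => ?_⟩
  · rw [h.coeffEquiv_apply, h.coeffHat_ιHat, Pi.single_apply]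
  · rw [h.coeffEquiv_apply, h.coeffHat_of, h.coeff_var, Pi.single_apply]
    split_ifs
    · exact map_one _
    · exact map_zero _
  · have hs : ∀ p : ℕ × ℕ, ∃ c, ∀ k N, k ≤ N → ∑ t ∈ Finset.range N,
        h.coeffHat (p.1 + t) f * skewCoeff h.τHat h.δHat (p.1 + t) (h.coeffHat p.2 g) p.1 - c
          ∈ level I k := fun p => by
      -- The `t`-th term lies in `level I t`, because `(y ^ (p.1 + t) r)_{p.1}` involves at least
      -- `t` applications of `δ`.
      refine exists_sum _ fun t => Ideal.mul_mem_left _ _ ?_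
      exact level_anti (by omega) (h.skewCoeff_hat_mem (mem_level_zero _) _ _)
    choose c hc using hs
    refine ⟨c, fun p _ k => ⟨k, fun i hi => ?_⟩, eq_of_sub_mem_level fun k => ?_⟩
    · rw [← hI]
      exact hc p k i hi
    · obtain ⟨N, hN⟩ := h.coeffHat_mul_sub_mem f g n k
      have h1 := hN (max N k) (le_max_left _ _)
      have h2 := sum_mem (t := Finset.HasAntidiagonal.antidiagonal n)
        fun p _ => hc p k (max N k) (le_max_right _ _)
      rw [Finset.sum_sub_distrib] at h2
      rw [h.coeffEquiv_apply]
      simpa using add_mem h1 h2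

/-- The tail is an exact left multiple of `y ^ k`: its cofactor is the power series with shifted
coefficients. This replaces limits by finite sums in statements about algebraic ideals. -/
theorem exists_eq_sum_add (x : RingCompletion J) (k : ℕ) : ∃ z, x =
    ∑ i ∈ Finset.range k, h.ιHat (h.coeffHat i x) * of J y ^ i + z * of J y ^ k := by
  obtain ⟨z, hz⟩ := h.exists_coeffHat_eq fun i => h.coeffHat (i + k) x
  refine ⟨z, h.coeffHat_ext fun i => ?_⟩
  rw [map_add, map_sum, h.coeffHat_mul_pow]
  simp only [h.coeffHat_monomial, Finset.sum_ite_eq, Finset.mem_range]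
  split_ifs with h1 h2 h2
  · omega
  · rw [add_zero]
  · rw [hz, zero_add, Nat.sub_add_cancel h2]
  · omega

/-- The first `k` terms lie in `level J 1 ^ (k - i) * level J 1 ^ i` and the tail is a multiple of
`y ^ k`, so no closure of the power is needed. -/
theorem level_le_pow (hI : ∀ k, level I k ≤ level I 1 ^ k) (k : ℕ) :
    level J k ≤ level J 1 ^ k := by
  intro x hx
  have hy : ∀ i, of J y ^ i ∈ level J 1 ^ i := fun i => by
    induction i with
    | zero => exact Ideal.mem_pow_zero _ _
    | succ i ih =>
      rw [pow_succ, Submodule.pow_succ]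
      exact Ideal.mul_mem_mul ih (by simpa using h.var_pow_mem 1)
  obtain ⟨z, hz⟩ := h.exists_eq_sum_add x k
  rw [hz]
  refine add_mem (sum_mem fun i _ => ?_) (Ideal.mul_mem_left _ _ (hy k))
  exact Ideal.mul_mem_pow_add (Ideal.map_mem_pow_of_forall (fun _ => h.ιHat_mem)
    (hI _ (h.coeffHat_mem (i := i) hx))) (hy i) (by omega)

end IsFilteredSkewPolynomialRing

/-! ### The Jacobson radical and maximal two-sided ideals -/

section Jacobson

variable {S : Type u} [Ring S]

theorem exists_mul_one_sub_eq_one {x : S} (hx : x ∈ Ring.jacobson S) : ∃ z, z * (1 - x) = 1 := by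
  rw [← Ideal.jacobson_bot, Ideal.mem_jacobson_iff] at hx
  obtain ⟨z, hz⟩ := hx (-1)
  refine ⟨z, ?_⟩
  rw [Ideal.mem_bot, sub_eq_zero] at hz
  calc z * (1 - x) = z * -1 * x + z := by noncomm_ring
    _ = 1 := hz

/-- If `S / J(S)` is simple, then `J(S)` is the unique maximal two-sided ideal. -/
theorem isCoatom_iff_eq_jacobson (hS : IsSimpleRing (S ⧸ Ring.jacobson S)) (M : TwoSidedIdeal S) :
    IsCoatom M ↔ M = (Ring.jacobson S).toTwoSided := by
  have hJ : IsCoatom (Ring.jacobson S).toTwoSided := by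
    obtain ⟨hn, hs⟩ := isSimpleRing_iff_isTwoSided_imp.1 hS
    refine ⟨fun h => ?_, fun N hN => ?_⟩
    · have h1 : (1 : S) ∈ (Ring.jacobson S).toTwoSided := h ▸ trivial
      rw [Ideal.mem_toTwoSided, ← Ideal.Quotient.eq_zero_iff_mem, map_one] at h1
      exact one_ne_zero h1
    -- As `N` contains the radical, it is the full preimage of its image in the simple quotient.
    · have hmem : ∀ x, Ideal.Quotient.mk (Ring.jacobson S) x ∈
          Ideal.map (Ideal.Quotient.mk (Ring.jacobson S)) N.asIdeal ↔ x ∈ N := fun x => by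
        rw [Ideal.mem_map_iff_of_surjective _ Ideal.Quotient.mk_surjective]
        refine ⟨fun ⟨a, ha, hax⟩ => ?_, fun hx => ⟨x, hx, rfl⟩⟩
        rw [Ideal.Quotient.eq] at hax
        simpa using N.sub_mem (TwoSidedIdeal.mem_asIdeal.1 ha)
          (hN.le (Ideal.mem_toTwoSided.2 hax))
      have ht : (Ideal.map (Ideal.Quotient.mk (Ring.jacobson S)) N.asIdeal).IsTwoSided :=
        ⟨fun {a} b ha => by
          obtain ⟨a, rfl⟩ := Ideal.Quotient.mk_surjective a
          obtain ⟨b, rfl⟩ := Ideal.Quotient.mk_surjective b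
          rw [← map_mul, hmem]
          exact N.mul_mem_right _ _ ((hmem a).1 ha)⟩
      rcases hs _ ht with h | h
      · refine absurd (fun x hx => ?_) hN.not_ge
        rw [← hmem, h, Ideal.mem_bot, Ideal.Quotient.eq_zero_iff_mem] at hx
        exact Ideal.mem_toTwoSided.2 hx
      · rw [← TwoSidedIdeal.one_mem_iff, ← hmem, h]
        trivial
  refine ⟨fun hM => ?_, fun h => h ▸ hJ⟩
  -- Otherwise `1 = a + b` with `a ∈ M` and `b` in the radical; then `a = 1 - b` has a left inverse
  -- and `M` is everything.
  have hle : (Ring.jacobson S).toTwoSided ≤ M := by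
    by_contra hle
    have h1 : (1 : S) ∈ M ⊔ (Ring.jacobson S).toTwoSided := by
      rw [hM.2 _ (lt_of_le_of_ne le_sup_left fun h => hle (h ▸ le_sup_right))]
      trivial
    obtain ⟨a, ha, b, hb, hab⟩ := TwoSidedIdeal.mem_sup.1 h1
    obtain ⟨z, hz⟩ := exists_mul_one_sub_eq_one (Ideal.mem_toTwoSided.1 hb)
    refine hM.1 ((TwoSidedIdeal.one_mem_iff M).1 ?_)
    rw [← hz, ← eq_sub_of_add_eq hab]
    exact M.mul_mem_left _ _ ha
  by_contra hne
  exact hM.1 (hJ.2 M (lt_of_le_of_ne hle (Ne.symm hne)))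

end Jacobson

/-! ### The Jacobson radical of a completion -/

namespace RingCompletion

variable {R : Type u} [Ring R] {I : Ideal R} [I.IsTwoSided]

/-- The geometric series in `-(y * x)` converges to a left inverse of `1 + y * x`. -/
theorem level_one_le_jacobson : level I 1 ≤ Ring.jacobson (RingCompletion I) := by
  intro x hx
  rw [← Ideal.jacobson_bot, Ideal.mem_jacobson_iff]
  intro y
  have hw : ∀ i, (-(y * x)) ^ i ∈ level I i := fun i => by
    induction i with
    | zero => exact mem_level_zero _
    | succ i ih => exact pow_succ (-(y * x)) i ▸
        mul_mem_level ih (neg_mem (Ideal.mul_mem_left _ _ hx))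
  obtain ⟨z, hz⟩ := exists_sum _ hw
  refine ⟨z, (Ideal.mem_bot).2 (eq_zero_of_mem_level fun k => ?_)⟩
  have e : z * y * x + z - 1 = -((∑ i ∈ Finset.range k, (-(y * x)) ^ i - z) * (1 - -(y * x)))
      - (-(y * x)) ^ k := by
    rw [sub_mul, geom_sum_mul_neg]
    noncomm_ring
  rw [e]
  exact sub_mem (neg_mem (Ideal.mul_mem_right _ _ (hz k k le_rfl))) (hw k)

/-- The radical of the simple quotient is a proper two-sided ideal, hence zero, so the radical
upstairs is contained in `level I 1`. -/
theorem jacobson_eq_level_one (hs : IsSimpleRing (RingCompletion I ⧸ level I 1)) :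
    Ring.jacobson (RingCompletion I) = level I 1 := by
  refine le_antisymm (Ring.jacobson_le_of_eq_bot ?_) level_one_le_jacobson
  obtain ⟨_, h⟩ := isSimpleRing_iff_isTwoSided_imp.1 hs
  exact (h _ inferInstance).resolve_right (Ring.jacobson_lt_top _).ne

theorem pow_level_one_le (k : ℕ) : level I 1 ^ k ≤ level I k := by
  induction k with
  | zero => rw [level_zero]; exact le_top
  | succ k ih =>
    rw [Submodule.pow_succ]
    exact Ideal.mul_le.2 fun a ha b hb => mul_mem_level (ih ha) hb

theorem isCompleteLocalRing (hs : IsSimpleRing (RingCompletion I ⧸ level I 1))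
    (ha : IsArtinianRing (RingCompletion I ⧸ level I 1))
    (hpow : ∀ k, level I k = Ring.jacobson (RingCompletion I) ^ k) :
    IsCompleteLocalRing (RingCompletion I) := by
  have hJ := jacobson_eq_level_one hs
  refine ⟨?_, ?_, fun x hx => eq_zero_of_mem_level fun k => hpow k ▸ hx k, fun a h => ?_⟩
  · exact hs.of_ringEquiv (Ideal.quotEquivOfEq hJ.symm)
  · exact (Ideal.quotEquivOfEq hJ.symm).isArtinianRing
  · simp only [IsAdicCauchy, AdicTendsto, ← hpow] at h ⊢
    exact exists_limit a h

theorem of_surjective (h : ∀ a : ℕ → R, IsAdicCauchy I a → ∃ L, AdicTendsto I a L) :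
    Function.Surjective (of I) := by
  intro x
  obtain ⟨L, hL⟩ := h (rep x) fun k => ⟨k, fun i j hi hj =>
    sub_mem_pow (level_anti hi (sub_of_rep_mem x i)) (level_anti hj (sub_of_rep_mem x j))⟩
  refine ⟨L, (eq_of_sub_mem_level fun k => ?_).symm⟩
  obtain ⟨N, hN⟩ := hL k
  have h1 := of_mem_level.2 (hN (max N k) (le_max_left _ _))
  have h2 := level_anti (le_max_right N k) (sub_of_rep_mem x (max N k))
  simpa using add_mem h2 h1

end RingCompletion

/-! ### Augmentation ideals in a tower -/

namespace SkewTower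

variable {C : Type u} [Ring C] {n : ℕ} (T : SkewTower C n)

theorem ofBase_zero (c : C) : T.ofBase 0 c = T.base c := rfl

theorem ofBase_succ (l : Fin n) (c : C) :
    T.ofBase l.succ c = T.incl l (T.ofBase l.castSucc c) := rfl

theorem vars_zero : T.vars 0 = ∅ := rfl

theorem vars_succ (l : Fin n) :
    T.vars l.succ = insert (T.y l) (T.incl l '' T.vars l.castSucc) := rfl

theorem ofBase_mem_augIdeal (l : Fin (n + 1)) {c : C} (hc : c ∈ Ring.jacobson C) :
    T.ofBase l c ∈ T.augIdeal l :=
  TwoSidedIdeal.mem_sup_left (TwoSidedIdeal.subset_span ⟨c, hc, rfl⟩)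

theorem span_vars_le_augIdeal (l : Fin (n + 1)) : TwoSidedIdeal.span (T.vars l) ≤ T.augIdeal l :=
  le_sup_right

theorem y_mem_span_vars (l : Fin n) : T.y l ∈ TwoSidedIdeal.span (T.vars l.succ) :=
  TwoSidedIdeal.subset_span (Set.mem_insert _ _)

theorem incl_mem_span_vars (l : Fin n) {r : T.obj l.castSucc}
    (hr : r ∈ TwoSidedIdeal.span (T.vars l.castSucc)) :
    T.incl l r ∈ TwoSidedIdeal.span (T.vars l.succ) := by
  have : TwoSidedIdeal.span (T.vars l.castSucc) ≤
      (TwoSidedIdeal.span (T.vars l.succ)).comap (T.incl l) :=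
    TwoSidedIdeal.span_le.2 fun z hz => (TwoSidedIdeal.mem_comap _).2
      (TwoSidedIdeal.subset_span (Set.mem_insert_of_mem _ ⟨z, hz, rfl⟩))
  exact (TwoSidedIdeal.mem_comap _).1 (this hr)

theorem incl_mem_augIdeal (l : Fin n) {r : T.obj l.castSucc} (hr : r ∈ T.augIdeal l.castSucc) :
    T.incl l r ∈ T.augIdeal l.succ := by
  have : T.augIdeal l.castSucc ≤ (T.augIdeal l.succ).comap (T.incl l) := by
    refine sup_le (TwoSidedIdeal.span_le.2 ?_) fun z hz => ?_
    · rintro _ ⟨c, hc, rfl⟩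
      exact (TwoSidedIdeal.mem_comap _).2 (T.ofBase_mem_augIdeal l.succ hc)
    · exact (TwoSidedIdeal.mem_comap _).2 (T.span_vars_le_augIdeal _ (T.incl_mem_span_vars l hz))
  exact (TwoSidedIdeal.mem_comap _).1 (this hr)

theorem mem_augIdeal_zero (x : T.obj 0) :
    x ∈ T.augIdeal 0 ↔ T.base.symm x ∈ Ring.jacobson C := by
  constructor
  · have : T.augIdeal 0 ≤
        (Ring.jacobson C).toTwoSided.comap (T.base.symm : T.obj 0 →+* C) := by
      refine sup_le (TwoSidedIdeal.span_le.2 ?_) (TwoSidedIdeal.span_le.2 ?_)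
      · rintro _ ⟨c, hc, rfl⟩
        refine (TwoSidedIdeal.mem_comap _).2 (Ideal.mem_toTwoSided.2 ?_)
        rw [T.ofBase_zero, RingEquiv.coe_toRingHom, RingEquiv.symm_apply_apply]
        exact hc
      · rw [vars_zero]
        exact Set.empty_subset _
    exact fun hx => Ideal.mem_toTwoSided.1 ((TwoSidedIdeal.mem_comap _).1 (this hx))
  · intro hx
    have := T.ofBase_mem_augIdeal 0 hx
    rwa [T.ofBase_zero, RingEquiv.apply_symm_apply] at this

/-- If every element of the next ring of the tower is a constant term plus a left multiple of the
variable, then the augmentation ideal consists of the elements with constant term in the previous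
augmentation ideal, as soon as these form an ideal. -/
theorem mem_augIdeal_succ (l : Fin n) (c : T.obj l.succ →+ T.obj l.castSucc)
    (hc : ∀ x, ∃ z, x = T.incl l (c x) + z * T.y l) (hincl : ∀ r, c (T.incl l r) = r)
    (hy : c (T.y l) = 0) (K : TwoSidedIdeal (T.obj l.succ))
    (hK : ∀ x, x ∈ K ↔ c x ∈ T.augIdeal l.castSucc) (x : T.obj l.succ) :
    x ∈ T.augIdeal l.succ ↔ c x ∈ T.augIdeal l.castSucc := by
  rw [← hK]
  constructor
  · have : T.augIdeal l.succ ≤ K := by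
      refine sup_le (TwoSidedIdeal.span_le.2 ?_) (TwoSidedIdeal.span_le.2 ?_)
      · rintro _ ⟨a, ha, rfl⟩
        refine (hK _).2 ?_
        rw [T.ofBase_succ, hincl]
        exact T.ofBase_mem_augIdeal _ ha
      · rw [vars_succ]
        refine Set.insert_subset ((hK _).2 ?_) ?_
        · rw [hy]
          exact TwoSidedIdeal.zero_mem _
        · rintro _ ⟨r, hr, rfl⟩
          refine (hK _).2 ?_
          rw [hincl]
          exact T.span_vars_le_augIdeal _ (TwoSidedIdeal.subset_span hr)
    exact fun hx => this hx
  · intro hx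
    obtain ⟨z, hz⟩ := hc x
    rw [hz]
    exact TwoSidedIdeal.add_mem _ (T.incl_mem_augIdeal l ((hK x).1 hx))
      (TwoSidedIdeal.mul_mem_left _ _ _ (T.span_vars_le_augIdeal _ (T.y_mem_span_vars l)))

/-- Applied to the completed tower, this yields both the surjection of `C` onto the residue ring and
the description of the maximal ideal as a sum. -/
theorem exists_eq_ofBase_add
    (h : ∀ (l : Fin n) (x : T.obj l.succ), ∃ r z, x = T.incl l r + z * T.y l)
    (l : Fin (n + 1)) (x : T.obj l) :
    ∃ c, ∃ z ∈ TwoSidedIdeal.span (T.vars l), x = T.ofBase l c + z := by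
  induction l using Fin.induction with
  | zero =>
    refine ⟨T.base.symm x, 0, TwoSidedIdeal.zero_mem _, ?_⟩
    rw [T.ofBase_zero, RingEquiv.apply_symm_apply, add_zero]
  | succ l ih =>
    obtain ⟨r, z, rfl⟩ := h l x
    obtain ⟨c, w, hw, rfl⟩ := ih r
    refine ⟨c, T.incl l w + z * T.y l, ?_, ?_⟩
    · exact TwoSidedIdeal.add_mem _ (T.incl_mem_span_vars l hw)
        (TwoSidedIdeal.mul_mem_left _ _ _ (T.y_mem_span_vars l))
    · rw [T.ofBase_succ, map_add, add_assoc]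

variable {T}

/-- All steps of the tower are skew polynomial rings whose skew derivations respect the filtration
by the powers of the augmentation ideal. -/
def IsFiltered (T : SkewTower C n) : Prop :=
  ∀ l : Fin n, IsFilteredSkewPolynomialRing (T.τ l) (T.δ l) (T.incl l) (T.y l)
    (T.augIdeal l.castSucc).asIdeal (T.augIdeal l.succ).asIdeal

theorem IsIteratedSkewPolynomialRing.isFiltered (hT : T.IsIteratedSkewPolynomialRing)
    (hτ : ∀ (l : Fin n), ∀ r ∈ T.augIdeal l.castSucc, T.τ l r ∈ T.augIdeal l.castSucc)
    (hδ : ∀ (l : Fin n) (r : T.obj l.castSucc), T.δ l r ∈ T.augIdeal l.castSucc)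
    (hδ₂ : ∀ (l : Fin n), ∀ r ∈ T.augIdeal l.castSucc,
      T.δ l r ∈ (T.augIdeal l.castSucc).asIdeal ^ 2) : T.IsFiltered := by
  intro l
  refine ⟨hT l, hτ l, hδ l, hδ₂ l, ?_⟩
  exact T.mem_augIdeal_succ l ((hT l).coeff 0) (hT l).exists_eq_map_add
    (fun r => by rw [(hT l).coeff_map, if_pos rfl]) (by rw [(hT l).coeff_var, if_neg (by omega)])
    ((hT l).constIdeal (I := (T.augIdeal l.castSucc).asIdeal) (hτ l) (hδ l) (hδ₂ l))
    (fun _ => (hT l).mem_constIdeal _ _ _)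

namespace IsFiltered

variable (hT : T.IsFiltered)

include hT

theorem ofBase_mem_augIdeal_iff (l : Fin (n + 1)) (c : C) :
    T.ofBase l c ∈ T.augIdeal l ↔ c ∈ Ring.jacobson C := by
  induction l using Fin.induction with
  | zero => rw [T.mem_augIdeal_zero, T.ofBase_zero, RingEquiv.symm_apply_apply]
  | succ l ih =>
    rw [← TwoSidedIdeal.mem_asIdeal, (hT l).mem_iff, T.ofBase_succ, (hT l).coeff_map, if_pos rfl]
    exact ih

theorem separated (hC : IsCompleteLocalRing C) (l : Fin (n + 1)) (x : T.obj l)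
    (hx : ∀ k, x ∈ (T.augIdeal l).asIdeal ^ k) : x = 0 := by
  induction l using Fin.induction with
  | zero =>
    refine (map_eq_zero_iff _ T.base.symm.injective).1 (hC.separated _ fun k => ?_)
    exact Ideal.map_mem_pow_of_forall (f := (T.base.symm : T.obj 0 →+* C))
      (fun r hr => (T.mem_augIdeal_zero r).1 hr) (hx k)
  | succ l ih => exact (hT l).separated ih x hx

end IsFiltered

/-- The ring at the bottom of the tower is complete, being isomorphic to `C`. -/
theorem exists_adicTendsto_zero (hC : IsCompleteLocalRing C) (a : ℕ → T.obj 0)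
    (ha : IsAdicCauchy (T.augIdeal 0).asIdeal a) :
    ∃ L, AdicTendsto (T.augIdeal 0).asIdeal a L := by
  obtain ⟨L, hL⟩ := hC.complete (fun i => T.base.symm (a i)) fun k =>
    (ha k).imp fun N hN i j hi hj => by
    rw [← map_sub]
    exact Ideal.map_mem_pow_of_forall (f := (T.base.symm : T.obj 0 →+* C))
      (fun r hr => (T.mem_augIdeal_zero r).1 hr) (hN i j hi hj)
  refine ⟨T.base L, fun k => (hL k).imp fun N hN i hi => ?_⟩
  have := Ideal.map_mem_pow_of_forall (f := (T.base : C →+* T.obj 0))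
    (J := (T.augIdeal 0).asIdeal) (fun c hc => T.ofBase_mem_augIdeal 0 hc) (hN i hi)
  simpa using this

/-- `C` is already complete and separated, so completing the bottom ring changes nothing and `S₀` is
again `C`. -/
theorem IsFiltered.bijective_of_base (hT : T.IsFiltered) (hC : IsCompleteLocalRing C) :
    Function.Bijective ((RingCompletion.of (T.augIdeal 0).asIdeal).comp (T.base : C →+* T.obj 0)) :=
  Function.Bijective.comp (g := RingCompletion.of (T.augIdeal 0).asIdeal)
    ⟨RingCompletion.of_injective (hT.separated hC 0),
      RingCompletion.of_surjective (exists_adicTendsto_zero hC)⟩ T.base.bijective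

/-! ### The completed tower -/

/-- The tower of the completions of the rings of a tower. -/
noncomputable def completion (hT : T.IsFiltered) (hC : IsCompleteLocalRing C) : SkewTower C n where
  obj l := RingCompletion (T.augIdeal l).asIdeal
  base := RingEquiv.ofBijective _ (hT.bijective_of_base hC)
  incl l := (hT l).ιHat
  y l := RingCompletion.of _ (T.y l)
  τ l := (hT l).τHat
  δ l := (hT l).δHat

section Completion

variable (hT : T.IsFiltered) (hC : IsCompleteLocalRing C)

theorem isExtension_completion :
    T.IsExtension (completion hT hC) fun l => of (T.augIdeal l).asIdeal where
  injective l := of_injective (hT.separated hC l)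
  base _ := rfl
  incl l r := ((hT l).ιHat_of r).symm
  y _ := rfl
  τ l r := (hT l).τHat_of r
  δ l r := (hT l).δHat_of r

theorem completion_ofBase (l : Fin (n + 1)) (c : C) :
    (completion hT hC).ofBase l c = of (T.augIdeal l).asIdeal (T.ofBase l c) := by
  induction l using Fin.induction with
  | zero => rfl
  | succ l ih => rw [ofBase_succ, ih]; exact (hT l).ιHat_of _

include hT in
theorem ofBase_mem_level_one (l : Fin (n + 1)) (c : C) :
    of (T.augIdeal l).asIdeal (T.ofBase l c) ∈ level (T.augIdeal l).asIdeal 1 ↔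
      c ∈ Ring.jacobson C := by
  rw [of_mem_level, Submodule.pow_one]
  exact hT.ofBase_mem_augIdeal_iff l c

theorem completion_exists_eq_incl_add (l : Fin n) (x : (completion hT hC).obj l.succ) :
    ∃ z, x = (completion hT hC).incl l ((hT l).coeffHat 0 x) + z * (completion hT hC).y l := by
  obtain ⟨z, hz⟩ := (hT l).exists_eq_sum_add x 1
  rw [Finset.sum_range_one, pow_zero, mul_one, pow_one] at hz
  exact ⟨z, hz⟩

/-- Both ideals are detected by the constant term at each step: an element is exactly its constant
term plus a left multiple of the variable, so the generated ideal is already closed. -/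
theorem completion_mem_augIdeal (l : Fin (n + 1)) (x : RingCompletion (T.augIdeal l).asIdeal) :
    x ∈ (completion hT hC).augIdeal l ↔ x ∈ level (T.augIdeal l).asIdeal 1 := by
  induction l using Fin.induction with
  | zero =>
    obtain ⟨c, rfl⟩ := (completion hT hC).base.surjective x
    refine (mem_augIdeal_zero (completion hT hC) _).trans ?_
    rw [RingEquiv.symm_apply_apply]
    exact (ofBase_mem_level_one hT 0 c).symm
  | succ l ih =>
    have h1 : ∀ x, x ∈ level (T.augIdeal l.succ).asIdeal 1 ↔
        (hT l).coeffHat 0 x ∈ (completion hT hC).augIdeal l.castSucc := fun x => by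
      rw [ih, (hT l).mem_level_iff]
      refine ⟨fun h => h 0, fun h i => ?_⟩
      obtain _ | i := i
      · exact h
      · exact level_anti (by omega) (mem_level_zero _)
    let K : TwoSidedIdeal (RingCompletion (T.augIdeal l.succ).asIdeal) :=
      (level (T.augIdeal l.succ).asIdeal 1).toTwoSided
    have hK : ∀ x, x ∈ K ↔ (hT l).coeffHat 0 x ∈ (completion hT hC).augIdeal l.castSucc :=
      fun x => Iff.trans Ideal.mem_toTwoSided (h1 x)
    rw [h1]
    exact (completion hT hC).mem_augIdeal_succ l ((hT l).coeffHat 0)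
      (completion_exists_eq_incl_add hT hC l)
      (fun r => ((hT l).coeffHat_ιHat r 0).trans (if_pos rfl))
      (by
        refine ((hT l).coeffHat_of 0 _).trans ?_
        rw [(hT l).coeff_var, if_neg (by omega), map_zero]
        rfl)
      K hK x

include hT hC

/-- At the bottom every element comes from the complete ring `R₀`, where levels are honest powers;
`level_le_pow` climbs the tower. -/
theorem level_le_pow_level_one (l : Fin (n + 1)) (k : ℕ) :
    level (T.augIdeal l).asIdeal k ≤ level (T.augIdeal l).asIdeal 1 ^ k := by
  induction l using Fin.induction generalizing k with
  | zero =>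
    intro x hx
    obtain ⟨r, rfl⟩ := of_surjective (exists_adicTendsto_zero hC) x
    exact Ideal.map_mem_pow_of_forall
      (fun r hr => of_mem_level.2 (by rwa [Submodule.pow_one])) (of_mem_level.1 hx)
  | succ l ih => exact (hT l).level_le_pow ih k

/-- The map from `C` is onto because every element is a constant modulo the variables, and its
kernel is `J(C)` because passing to constant terms leaves constants unchanged. -/
theorem nonempty_residueRing_equiv (l : Fin (n + 1)) : Nonempty ((C ⧸ Ring.jacobson C) ≃+*
    (RingCompletion (T.augIdeal l).asIdeal ⧸ level (T.augIdeal l).asIdeal 1)) := by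
  have hker : ∀ c, Ideal.Quotient.mk (level (T.augIdeal l).asIdeal 1)
      (of (T.augIdeal l).asIdeal (T.ofBase l c)) = 0 ↔ c ∈ Ring.jacobson C := fun c => by
    rw [Ideal.Quotient.eq_zero_iff_mem, ofBase_mem_level_one hT]
  refine ⟨RingEquiv.ofBijective (Ideal.Quotient.lift (Ring.jacobson C)
    ((Ideal.Quotient.mk (level (T.augIdeal l).asIdeal 1)).comp
      ((of (T.augIdeal l).asIdeal).comp (T.ofBase l))) fun c hc => (hker c).2 hc) ⟨?_, ?_⟩⟩
  · refine (injective_iff_map_eq_zero _).2 fun q hq => ?_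
    obtain ⟨c, rfl⟩ := Ideal.Quotient.mk_surjective q
    exact Ideal.Quotient.eq_zero_iff_mem.2 ((hker c).1 hq)
  · intro q
    obtain ⟨x, rfl⟩ := Ideal.Quotient.mk_surjective q
    obtain ⟨c, z, hz, hx⟩ := (completion hT hC).exists_eq_ofBase_add
      (fun l x => ⟨_, completion_exists_eq_incl_add hT hC l x⟩) l x
    have hx' : x - of (T.augIdeal l).asIdeal (T.ofBase l c) = z :=
      sub_eq_of_eq_add' (hx.trans (congrArg (· + z) (completion_ofBase hT hC l c)))
    refine ⟨Ideal.Quotient.mk _ c, (Ideal.Quotient.eq.2 ?_).symm⟩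
    rw [RingHom.comp_apply, hx']
    exact (completion_mem_augIdeal hT hC l _).1 (span_vars_le_augIdeal _ l hz)

theorem jacobson_completion (l : Fin (n + 1)) :
    Ring.jacobson (RingCompletion (T.augIdeal l).asIdeal) = level (T.augIdeal l).asIdeal 1 := by
  obtain ⟨e⟩ := nonempty_residueRing_equiv hT hC l
  exact jacobson_eq_level_one (hC.simple.of_ringEquiv e)

theorem level_eq_jacobson_pow (l : Fin (n + 1)) (k : ℕ) :
    level (T.augIdeal l).asIdeal k = Ring.jacobson (RingCompletion (T.augIdeal l).asIdeal) ^ k := by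
  rw [jacobson_completion hT hC]
  exact le_antisymm (level_le_pow_level_one hT hC l k) (pow_level_one_le k)

theorem isCompleteLocalRing_completion (l : Fin (n + 1)) :
    IsCompleteLocalRing (RingCompletion (T.augIdeal l).asIdeal) := by
  obtain ⟨e⟩ := nonempty_residueRing_equiv hT hC l
  have := hC.artinian
  exact isCompleteLocalRing (hC.simple.of_ringEquiv e) e.isArtinianRing
    (level_eq_jacobson_pow hT hC l)

theorem isIteratedSkewPowerSeriesRing_completion :
    (completion hT hC).IsIteratedSkewPowerSeriesRing := fun l =>
  (hT l).isSkewPowerSeriesRing_hat (level_eq_jacobson_pow hT hC l.castSucc)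

theorem completion_jacobson_eq_augIdeal (l : Fin (n + 1)) :
    Ring.jacobson ((completion hT hC).obj l) = ((completion hT hC).augIdeal l).asIdeal :=
  (jacobson_completion hT hC l).trans
    (Ideal.ext fun x => ((completion_mem_augIdeal hT hC l x).symm))

theorem completion_mem_augIdeal_iff_exists (l : Fin (n + 1)) (x : (completion hT hC).obj l) :
    x ∈ (completion hT hC).augIdeal l ↔ ∃ c ∈ Ring.jacobson C,
      ∃ z ∈ TwoSidedIdeal.span ((completion hT hC).vars l),
        x = (completion hT hC).ofBase l c + z := by
  constructor
  · intro hx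
    obtain ⟨c, z, hz, rfl⟩ := (completion hT hC).exists_eq_ofBase_add
      (fun l x => ⟨_, completion_exists_eq_incl_add hT hC l x⟩) l x
    refine ⟨c, ?_, z, hz, rfl⟩
    have := TwoSidedIdeal.sub_mem _ hx (span_vars_le_augIdeal _ l hz)
    rw [add_sub_cancel_right, completion_ofBase] at this
    exact (ofBase_mem_level_one hT l c).1 ((completion_mem_augIdeal hT hC l _).1 this)
  · rintro ⟨c, hc, z, hz, rfl⟩
    exact TwoSidedIdeal.add_mem _ (ofBase_mem_augIdeal _ l hc) (span_vars_le_augIdeal _ l hz)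

end Completion

end SkewTower

theorem theorem2p1 {C : Type u} [Ring C] (hC : IsCompleteLocalRing C) (n : ℕ)
    (R : SkewTower C n) (hR : R.IsIteratedSkewPolynomialRing)
    (hτ : ∀ (l : Fin n), ∀ r ∈ R.augIdeal l.castSucc, R.τ l r ∈ R.augIdeal l.castSucc)
    (hδ : ∀ (l : Fin n) (r : R.obj l.castSucc), R.δ l r ∈ R.augIdeal l.castSucc)
    (hδ₂ : ∀ (l : Fin n), ∀ r ∈ R.augIdeal l.castSucc,
      R.δ l r ∈ (R.augIdeal l.castSucc).asIdeal ^ 2) :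
    ∃ (S : SkewTower C n) (φ : ∀ l, R.obj l →+* S.obj l),
      S.IsIteratedSkewPowerSeriesRing ∧
      R.IsExtension S φ ∧
      ∀ l : Fin (n + 1),
        IsCompleteLocalRing (S.obj l) ∧
        Ring.jacobson (S.obj l) = (S.augIdeal l).asIdeal ∧
        (∀ M : TwoSidedIdeal (S.obj l), IsCoatom M ↔ M = S.augIdeal l) ∧
        (∀ x : S.obj l, x ∈ S.augIdeal l ↔
          ∃ c ∈ Ring.jacobson C, ∃ z ∈ TwoSidedIdeal.span (S.vars l), x = S.ofBase l c + z) := by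
  have hF : R.IsFiltered := hR.isFiltered hτ hδ hδ₂
  refine ⟨SkewTower.completion hF hC, fun l => RingCompletion.of (R.augIdeal l).asIdeal,
    SkewTower.isIteratedSkewPowerSeriesRing_completion hF hC,
    SkewTower.isExtension_completion hF hC, fun l => ?_⟩
  have hl : IsCompleteLocalRing ((SkewTower.completion hF hC).obj l) :=
    SkewTower.isCompleteLocalRing_completion hF hC l
  have hJ := SkewTower.completion_jacobson_eq_augIdeal hF hC l
  refine ⟨hl, hJ, fun M => ?_, SkewTower.completion_mem_augIdeal_iff_exists hF hC l⟩
  rw [isCoatom_iff_eq_jacobson hl.simple]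
  have hK : (Ring.jacobson ((SkewTower.completion hF hC).obj l)).toTwoSided =
      (SkewTower.completion hF hC).augIdeal l :=
    TwoSidedIdeal.ext fun x => by
      rw [Ideal.mem_toTwoSided, hJ, TwoSidedIdeal.mem_asIdeal]
  rw [hK]
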